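/- Let $Y$ be a complex manifold (Hausdorff and second countable, without boundary) of complex dimension $n \ge 0$, and let $K \to Y$ be a holomorphic vector bundle of complex rank $k \ge 1$. Then the total space of $K$, which is a complex manifold of complex dimension $n+k$, has vanishing top-degree Dolbeault cohomology: $$H^{0,n+k}(K) = \frac{\ker\bigl(\bar\partial \colon \Omega^{0,n+k}(K) \to \Omega^{0,n+k+1}(K)\bigr)}{\bar\partial\,\Omega^{0,n+k-1}(K)} = 0,$$ where $\Omega^{0,q}(K)$ denotes the space of smooth complex-valued differential forms of type $(0,q)$ on $K$. -/

import Mathlib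

open Bundle Set
open scoped Manifold ContDiff Topology

noncomputable section

namespace Dolbeault

/-! ### Forms of type `(0,q)` on a complex vector space and the operator `∂̄` -/

section Local

variable {E : Type*} [NormedAddCommGroup E] [NormedSpace ℂ E]

/-- A complex-valued real-multilinear alternating form is of type `(0,q)` if it is
conjugate-linear over `ℂ` in each of its arguments. -/
def IsType0 {V : Type*} [AddCommGroup V] [Module ℂ V] [TopologicalSpace V] {q : ℕ}
    (θ : V [⋀^Fin q]→L[ℝ] ℂ) : Prop :=
  ∀ (v : Fin q → V) (i : Fin q) (c : ℂ),
    θ (Function.update v i (c • v i)) = (starRingEnd ℂ) c * θ v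

/-- The conjugate-linear part `v ↦ (L v + i L (i v)) / 2` of a real-linear map `L` between
complex vector spaces. -/
def antilinearPart {W : Type*} [NormedAddCommGroup W] [NormedSpace ℝ W] [NormedSpace ℂ W]
    [SMulCommClass ℝ ℂ W] (L : E →L[ℝ] W) : E →L[ℝ] W :=
  (1 / 2 : ℂ) • (L + Complex.I • L.comp (Complex.I • ContinuousLinearMap.id ℝ E))

lemma antilinearPart_add {W : Type*} [NormedAddCommGroup W] [NormedSpace ℝ W] [NormedSpace ℂ W]
    [SMulCommClass ℝ ℂ W] (L L' : E →L[ℝ] W) :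
    antilinearPart (L + L') = antilinearPart L + antilinearPart L' := by
  ext v
  simp only [antilinearPart, add_apply, smul_apply,
    ContinuousLinearMap.comp_apply]
  module

lemma antilinearPart_smul {W : Type*} [NormedAddCommGroup W] [NormedSpace ℝ W] [NormedSpace ℂ W]
    [SMulCommClass ℝ ℂ W] (c : ℂ) (L : E →L[ℝ] W) :
    antilinearPart (c • L) = c • antilinearPart L := by
  ext v
  simp only [antilinearPart, add_apply, smul_apply,
    ContinuousLinearMap.comp_apply]
  module

/-- The operator `∂̄` on forms `η` of type `(0,q)` on a complex vector space:
`(∂̄η)_z (v₀, …, v_q) = ∑ᵢ (-1)ⁱ (∂̄_{vᵢ} η)_z (v₀, …, v̂ᵢ, …, v_q)`, where `∂̄_v η` is the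
conjugate-linear part of the derivative of `η`, evaluated at `v`; in linear coordinates this is
`∂̄ (∑ f_J dz̄_J) = ∑ ∂f_J/∂z̄_j dz̄_j ∧ dz̄_J`. -/
def dbarLocal {q : ℕ} (η : E → E [⋀^Fin q]→L[ℝ] ℂ) (z : E) : E [⋀^Fin (q + 1)]→L[ℝ] ℂ :=
  ContinuousAlternatingMap.alternatizeUncurryFin (antilinearPart (fderiv ℝ η z))

end Local

/-! ### Forms of type `(0,q)` on a complex manifold -/

section Manifold

variable {E : Type*} [NormedAddCommGroup E] [NormedSpace ℂ E]
  {H : Type*} [TopologicalSpace H] (I : ModelWithCorners ℂ E H) 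
  (M : Type*) [TopologicalSpace M] [ChartedSpace H M]

/-- Arbitrary (not necessarily smooth) fields of complex-valued real `q`-forms on `M`. -/
def FormField (q : ℕ) : Type _ := (x : M) → TangentSpace I x [⋀^Fin q]→L[ℝ] ℂ

instance (q : ℕ) : AddCommGroup (FormField I M q) :=
  inferInstanceAs (AddCommGroup ((x : M) → TangentSpace I x [⋀^Fin q]→L[ℝ] ℂ))

instance (q : ℕ) : Module ℂ (FormField I M q) :=
  inferInstanceAs (Module ℂ ((x : M) → TangentSpace I x [⋀^Fin q]→L[ℝ] ℂ))

variable {I M}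

/-- The expression of a field of forms in the chart around `x₀`, that is, its pullback under the
inverse of that chart. It is meaningful on the target of the chart. -/
def FormField.inChart {q : ℕ} (β : FormField I M q) (x₀ : M) (z : E) : E [⋀^Fin q]→L[ℝ] ℂ :=
  (β ((extChartAt I x₀).symm z)).compContinuousLinearMap
    ((mfderiv 𝓘(ℂ, E) I (extChartAt I x₀).symm z).restrictScalars ℝ)

/-- The field `∂̄β`: at `x`, apply `∂̄` in the chart around `x` and pull back under that chart. -/
def FormField.dbar {q : ℕ} (β : FormField I M q) : FormField I M (q + 1) := fun x =>
  (dbarLocal (β.inChart x) (extChartAt I x x)).compContinuousLinearMap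
    ((mfderiv I 𝓘(ℂ, E) (extChartAt I x) x).restrictScalars ℝ)

lemma FormField.add_apply {q : ℕ} (β γ : FormField I M q) (x : M) : (β + γ) x = β x + γ x := rfl

lemma FormField.smul_apply {q : ℕ} (c : ℂ) (β : FormField I M q) (x : M) :
    (c • β) x = c • β x := rfl

lemma FormField.zero_apply {q : ℕ} (x : M) : (0 : FormField I M q) x = 0 := rfl

lemma inChart_add {q : ℕ} (β γ : FormField I M q) (x₀ : M) :
    FormField.inChart (β + γ) x₀ = β.inChart x₀ + γ.inChart x₀ := by
  ext z v; rfl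

lemma inChart_smul {q : ℕ} (c : ℂ) (β : FormField I M q) (x₀ : M) :
    FormField.inChart (c • β) x₀ = c • β.inChart x₀ := by
  ext z v; rfl

variable (I M)

/-- The complex vector space `Ω^{0,q}(M)` of smooth forms of type `(0,q)` on `M`. -/
def forms (q : ℕ) : Submodule ℂ (FormField I M q) where
  carrier := {β | (∀ x, IsType0 (β x)) ∧
    ∀ x₀ : M, ContDiffOn ℝ ∞ (β.inChart x₀) (extChartAt I x₀).target}
  add_mem' := by
    rintro β γ ⟨hβ, hβ'⟩ ⟨hγ, hγ'⟩
    refine ⟨fun x v i c => ?_, fun x₀ => ?_⟩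
    · simp [FormField.add_apply, hβ x v i c, hγ x v i c, mul_add]
    · rw [inChart_add]
      exact (hβ' x₀).add (hγ' x₀)
  zero_mem' := by
    refine ⟨fun x v i c => by simp [FormField.zero_apply], fun x₀ => ?_⟩
    have h : FormField.inChart (0 : FormField I M q) x₀ = fun _ => 0 := by
      ext z v; rfl
    rw [h]
    exact contDiffOn_const
  smul_mem' := by
    rintro a β ⟨hβ, hβ'⟩
    refine ⟨fun x v i c => ?_, fun x₀ => ?_⟩
    · simp [FormField.smul_apply, hβ x v i c, mul_left_comm]
    · rw [inChart_smul]
      exact (hβ' x₀).const_smul a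

variable {I M} [I.Boundaryless]

lemma differentiableAt_inChart {q : ℕ} {β : FormField I M q} (hβ : β ∈ forms I M q) (x : M) :
    DifferentiableAt ℝ (β.inChart x) (extChartAt I x x) :=
  ((hβ.2 x).contDiffAt ((isOpen_extChartAt_target x).mem_nhds (mem_extChartAt_target x))
    ).differentiableAt (by simp)

lemma dbar_add {q : ℕ} {β γ : FormField I M q} (hβ : β ∈ forms I M q) (hγ : γ ∈ forms I M q) :
    FormField.dbar (β + γ) = β.dbar + γ.dbar := by
  funext x
  have h : dbarLocal (FormField.inChart (β + γ) x) (extChartAt I x x)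
      = dbarLocal (β.inChart x) (extChartAt I x x)
        + dbarLocal (γ.inChart x) (extChartAt I x x) := by
    rw [inChart_add, dbarLocal, dbarLocal, dbarLocal,
      fderiv_add (differentiableAt_inChart hβ x) (differentiableAt_inChart hγ x),
      antilinearPart_add, ContinuousAlternatingMap.alternatizeUncurryFin_add]
  ext v
  simp only [FormField.dbar, h]
  rfl

lemma dbar_smul {q : ℕ} (c : ℂ) {β : FormField I M q} (hβ : β ∈ forms I M q) :
    FormField.dbar (c • β) = c • β.dbar := by
  funext x
  have h : dbarLocal (FormField.inChart (c • β) x) (extChartAt I x x)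
      = c • dbarLocal (β.inChart x) (extChartAt I x x) := by
    rw [inChart_smul, dbarLocal, dbarLocal,
      fderiv_const_smul (differentiableAt_inChart hβ x), antilinearPart_smul]
    ext v
    simp [ContinuousAlternatingMap.alternatizeUncurryFin_apply, Finset.mul_sum]
  ext v
  simp only [FormField.dbar, h]
  rfl

lemma dbar_zero {q : ℕ} : FormField.dbar (0 : FormField I M q) = 0 := by
  simpa using dbar_smul (0 : ℂ) (forms I M q).zero_mem

variable (I M)

/-- The `∂̄`-closed smooth forms of type `(0,q)`. -/
def closedForms (q : ℕ) : Submodule ℂ (FormField I M q) where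
  carrier := {β | β ∈ forms I M q ∧ β.dbar = 0}
  add_mem' := by
    rintro β γ ⟨hβ, hβ'⟩ ⟨hγ, hγ'⟩
    exact ⟨add_mem hβ hγ, by rw [dbar_add hβ hγ, hβ', hγ', add_zero]⟩
  zero_mem' := ⟨zero_mem _, dbar_zero⟩
  smul_mem' := by
    rintro a β ⟨hβ, hβ'⟩
    exact ⟨(forms I M q).smul_mem a hβ, by rw [dbar_smul a hβ, hβ', smul_zero]⟩

/-- The `∂̄`-exact smooth forms of type `(0,q)`: those of the form `∂̄α` with `α` a smooth form of
type `(0,q-1)`; in degree `0` only the zero form. -/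
def exactForms : (q : ℕ) → Submodule ℂ (FormField I M q)
  | 0 => ⊥
  | q + 1 =>
    { carrier := {β | β ∈ forms I M (q + 1) ∧ ∃ α ∈ forms I M q, α.dbar = β}
      add_mem' := by
        rintro β γ ⟨hβ, α, hα, rfl⟩ ⟨hγ, α', hα', rfl⟩
        exact ⟨add_mem hβ hγ, α + α', add_mem hα hα', dbar_add hα hα'⟩
      zero_mem' := ⟨zero_mem _, 0, zero_mem _, dbar_zero⟩
      smul_mem' := by
        rintro a β ⟨hβ, α, hα, rfl⟩
        exact ⟨(forms I M (q + 1)).smul_mem a hβ, a • α, (forms I M q).smul_mem a hα,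
          dbar_smul a hα⟩ }

/-- The Dolbeault cohomology `H^{0,q}(M)`: closed forms of type `(0,q)` modulo exact ones. -/
abbrev Cohomology (q : ℕ) : Type _ :=
  closedForms I M q ⧸ (exactForms I M q).submoduleOf (closedForms I M q)

end Manifold

end Dolbeault

end

/-!
The total space of `K` is covered by the tubes `π⁻¹(U)` over small open subsets `U` of the base
`Y`, and these tubes are products `U × F`. A form of type `(0, n + k)` has top degree, so it is
automatically `∂̄`-closed, and it has to be shown that it is `∂̄`-exact.

Multiplying a given form by the functions `χᵢ ∘ π` of a smooth partition of unity on `Y`, one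
may assume that it is supported over a compact subset of a chart domain of `Y` that trivializes
`K` (`smul_proj_mem_forms`). It then vanishes outside a closed union of fibres, which in the
resulting chart of `K` is a union of complex lines parallel to a fixed vector `e` of the fibre; such
a nonzero `e` exists because `k ≥ 1`. If the equation in the chart can be solved with a primitive
that vanishes on every such line on which the right-hand side vanishes, then the primitive extends
by zero to all of `K` (`exists_dbar_eq_of_support`), and the primitives obtained for the various `i`
form a locally finite family, whose sum is the primitive sought (`exists_dbar_eq_of_locallyFinite`).
The products with `χᵢ ∘ π` need not be closed in general, but are so here, having top degree.

On a complex vector space, a form of top degree is `η = f κ` for a constant form `κ` and a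
function `f`, and `∂̄ (g ι_e κ) = (∂g/∂ē) κ`, so everything reduces to the scalar equation
`∂g/∂ē = f` (`exists_dbarLocal_eq`). Choosing `e` as one coordinate vector, this is the
equation `∂g/∂w̄ = f` on `X × ℂ`, where `x ∈ X` is a parameter (`exists_wirtinger_eq`). For `f`
supported in a bounded range of `w`, it is solved by the Cauchy transform in `w`, by the
Cauchy–Pompeiu formula (`cauchyPompeiu`, `wirtinger_cauchyTransform`). In general `f` is cut into
a piece with `|w| ≤ 2` and pieces `h_m` supported in annuli `2m + 1 ≤ |w| ≤ 2m + 4`. The equation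
for `h_m` is also solved by `w ^ N` times the Cauchy transform of `h_m / w ^ N`, and for large `N`
this function is small on the ball of radius `m`, together with its derivatives of order at most `m`
(`eventually_norm_iteratedFDeriv_pow_mul_cauchyTransform_le`). Hence the sum of these solutions
converges to a smooth function. The operation is linear and local in the parameter `x`, so lines on
which `f` vanishes are preserved. This explicit choice of `w ^ N` replaces Runge approximation,
which would have to be made to depend smoothly on `x`.

The operator `∂̄` on a manifold is defined through the chart around each point. That it may be
computed in any chart is `dbarLocal_pullback`: on forms of type `(0,q)`, it is a combination
of the exterior derivative and its composition with multiplication by `i`, both of which are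
compatible with holomorphic maps.
-/

noncomputable section

namespace Dolbeault

open MeasureTheory

/-! ### The Cauchy–Pompeiu formula -/

lemma locallyIntegrable_inv : LocallyIntegrable (fun t : ℂ => t⁻¹) := by
  rw [locallyIntegrable_iff]
  intro K hK
  obtain ⟨R, hR⟩ := hK.isBounded.subset_closedBall 0
  refine IntegrableOn.mono_set ?_ hR
  rw [← integrable_indicator_iff measurableSet_closedBall]
  -- In polar coordinates the Jacobian `r` cancels the singularity.
  have h : Integrable (fun t : ℂ => (Iic R).indicator (fun r : ℝ => r⁻¹) ‖t‖) := by
    rw [integrable_fun_norm_addHaar volume (f := (Iic R).indicator fun r : ℝ => r⁻¹)]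
    have hc : IntegrableOn (fun _ : ℝ => (1 : ℝ)) (Ioc 0 R) := by
      simp
    rw [← integrable_indicator_iff measurableSet_Ioc] at hc
    rw [← integrable_indicator_iff measurableSet_Ioi]
    refine hc.congr (Filter.Eventually.of_forall fun r => ?_)
    by_cases h0 : 0 < r
    · by_cases h1 : r ≤ R <;> simp [indicator, h0, h1, h0.ne']
    · simp [indicator, h0]
  refine h.mono (Measurable.aestronglyMeasurable ?_) (Filter.Eventually.of_forall fun t => ?_)
  · exact (measurable_inv.indicator measurableSet_closedBall)
  · by_cases ht : ‖t‖ ≤ R <;> simp [indicator, ht]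

lemma exists_norm_le_of_hasCompactSupport {φ : ℂ → ℂ} (hc : HasCompactSupport φ) :
    ∃ R : ℝ, 0 < R ∧ ∀ t, R < ‖t‖ → φ t = 0 := by
  obtain ⟨R, hR0, hR⟩ := hc.isCompact.isBounded.subset_closedBall_lt 0 0
  refine ⟨R, hR0, fun t ht => ?_⟩
  by_contra h
  have := hR (subset_tsupport _ h)
  simp at this
  linarith

/-- The Cauchy–Pompeiu formula for compactly supported functions. In polar coordinates, the
integrand is the sum of half of the radial derivative of `φ`, which integrates to `-φ 0 / 2` along
each ray, and a multiple of the angular derivative, which integrates to zero along each circle. -/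
lemma cauchyPompeiu {φ : ℂ → ℂ} (hφ : ContDiff ℝ 1 φ) (hc : HasCompactSupport φ) :
    ∫ t : ℂ, t⁻¹ * ((fderiv ℝ φ t 1 + Complex.I * fderiv ℝ φ t Complex.I) / 2)
      = -(Real.pi : ℂ) * φ 0 := by
  obtain ⟨R, hR0, hR⟩ := exists_norm_le_of_hasCompactSupport hc
  have hD : Continuous (fderiv ℝ φ) := hφ.continuous_fderiv one_ne_zero
  have hDR : ∀ t, R < ‖t‖ → fderiv ℝ φ t = 0 := fun t ht => by
    have : φ =ᶠ[𝓝 t] fun _ => 0 := by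
      filter_upwards [(isOpen_lt continuous_const continuous_norm).mem_nhds ht] with s hs
      exact hR s hs
    rw [this.fderiv_eq]; simp
  rw [← Complex.integral_comp_polarCoord_symm]
  set e : ℝ → ℂ := fun θ => Real.cos θ + Real.sin θ * Complex.I with he
  have hec : Continuous e := by fun_prop
  have hen : ∀ θ, ‖e θ‖ = 1 := fun θ => by
    simp only [he]
    rw [Complex.ofReal_cos, Complex.ofReal_sin, ← Complex.exp_mul_I]
    exact Complex.norm_exp_ofReal_mul_I θ
  have hde : ∀ θ, HasDerivAt e (Complex.I * e θ) θ := fun θ => by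
    have h1 := (Real.hasDerivAt_cos θ).ofReal_comp
    have h2 := ((Real.hasDerivAt_sin θ).ofReal_comp).mul_const Complex.I
    convert! h1.add h2 using 1
    simp only [he]
    push_cast
    linear_combination (Complex.sin θ) * Complex.I_mul_I
  -- the radial derivative of `φ`, and the angular derivative divided by the radius
  set A : ℝ × ℝ → ℂ := fun p => fderiv ℝ φ (p.1 * e p.2) (e p.2) with hA
  set B : ℝ × ℝ → ℂ := fun p => fderiv ℝ φ (p.1 * e p.2) (Complex.I * e p.2) with hB
  have hint : ∀ p ∈ polarCoord.target, p.1 • ((Complex.polarCoord.symm p)⁻¹ *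
      ((fderiv ℝ φ (Complex.polarCoord.symm p) 1 +
        Complex.I * fderiv ℝ φ (Complex.polarCoord.symm p) Complex.I) / 2)) =
      (1 / 2 : ℂ) * A p + (Complex.I / 2) * B p := by
    rintro ⟨r, θ⟩ hp
    have hr : 0 < r := by simpa using hp.1
    have hr' : (r : ℂ) ≠ 0 := by exact_mod_cast hr.ne'
    have hz : Complex.polarCoord.symm (r, θ) = r * e θ := by
      simp [Complex.polarCoord_symm_apply, he]
    rw [hz]
    simp only [hA, hB]
    set L := fderiv ℝ φ (r * e θ)
    have e1 : L (e θ) = Real.cos θ * L 1 + Real.sin θ * L Complex.I := by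
      have : e θ = Real.cos θ • (1 : ℂ) + Real.sin θ • Complex.I := by simp [he]
      rw [this, map_add, map_smul, map_smul]; simp
    have e2 : L (Complex.I * e θ) = Real.cos θ * L Complex.I - Real.sin θ * L 1 := by
      have : Complex.I * e θ = Real.cos θ • Complex.I - Real.sin θ • (1 : ℂ) := by
        simp only [he, Complex.real_smul]
        linear_combination Real.sin θ * Complex.I_mul_I
      rw [this, map_sub, map_smul, map_smul]; simp
    rw [e1, e2]
    have hinv : (e θ)⁻¹ = Real.cos θ - Real.sin θ * Complex.I := by
      refine inv_eq_of_mul_eq_one_left ?_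
      simp only [he]
      have := Complex.cos_sq_add_sin_sq (θ : ℂ)
      push_cast
      linear_combination this - (Complex.sin θ)^2 * Complex.I_mul_I
    rw [mul_inv, hinv, Complex.real_smul]
    field_simp
    linear_combination (-Real.sin θ * L Complex.I) * Complex.I_mul_I
  rw [setIntegral_congr_fun (polarCoord.open_target.measurableSet) hint]
  have htarget : polarCoord.target = Ioi (0 : ℝ) ×ˢ Ioo (-Real.pi) Real.pi := rfl
  rw [htarget]
  have hABc : ∀ C : ℝ × ℝ → ℂ, Continuous C → (∀ p, R < p.1 → C p = 0) →
      IntegrableOn C (Ioi (0 : ℝ) ×ˢ Ioo (-Real.pi) Real.pi) (volume.prod volume) := by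
    intro C hC hCR
    have h1 : IntegrableOn C (Icc 0 R ×ˢ Icc (-Real.pi) Real.pi) (volume.prod volume) :=
      hC.continuousOn.integrableOn_compact (isCompact_Icc.prod isCompact_Icc)
    refine IntegrableOn.of_forall_sdiff_eq_zero h1 (measurableSet_Ioi.prod measurableSet_Ioo) ?_
    rintro ⟨r, θ⟩ ⟨⟨h2, h3⟩, h4⟩
    apply hCR
    by_contra h5
    exact h4 ⟨⟨le_of_lt h2, not_lt.1 h5⟩, Ioo_subset_Icc_self h3⟩
  have hnr : ∀ p : ℝ × ℝ, R < p.1 → R < ‖(p.1 : ℂ) * e p.2‖ := fun p hp => by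
    rw [norm_mul, hen, mul_one, Complex.norm_real, Real.norm_eq_abs]
    exact hp.trans_le (le_abs_self _)
  have hAi := hABc A (by simp only [hA]; fun_prop) (fun p hp => by simp [hA, hDR _ (hnr p hp)])
  have hBi := hABc B (by simp only [hB]; fun_prop) (fun p hp => by simp [hB, hDR _ (hnr p hp)])
  rw [Measure.volume_eq_prod, integral_add (hAi.const_mul _) (hBi.const_mul _),
    integral_const_mul, integral_const_mul]
  have hAval : ∫ p in Ioi (0 : ℝ) ×ˢ Ioo (-Real.pi) Real.pi, A p ∂(volume.prod volume)
      = -(2 * Real.pi : ℝ) * φ 0 := by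
    rw [IntegrableOn, ← Measure.prod_restrict] at hAi
    rw [← Measure.prod_restrict]
    rw [integral_prod_symm _ hAi]
    have : ∀ θ, ∫ r in Ioi (0 : ℝ), A (r, θ) = - φ 0 := fun θ => by
      have hc1 : ContDiff ℝ 1 fun r : ℝ => φ (r * e θ) := by
        apply hφ.comp
        exact (Complex.ofRealCLM.contDiff).mul contDiff_const
      have hc2 : HasCompactSupport fun r : ℝ => φ (r * e θ) := by
        refine HasCompactSupport.intro (isCompact_Icc (a := -R) (b := R)) fun r hr => hR _ ?_
        rw [norm_mul, hen, mul_one, Complex.norm_real, Real.norm_eq_abs]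
        by_contra h
        exact hr (abs_le.1 (not_lt.1 h))
      have := hc2.integral_Ioi_deriv_eq hc1 0
      simp only [Complex.ofReal_zero, zero_mul] at this
      rw [← this]
      refine integral_congr_ae (Filter.Eventually.of_forall fun r => ?_)
      have h1 : HasDerivAt (fun r : ℝ => (r : ℂ) * e θ) (e θ) r := by
        simpa using (Complex.ofRealCLM.hasDerivAt (x := r)).mul_const (e θ)
      have h2 := ((hφ.differentiable one_ne_zero) (r * e θ)).hasFDerivAt.comp_hasDerivAt r h1
      exact h2.deriv.symm
    simp_rw [this]
    simp [Real.pi_pos.le]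
    left; ring
  have hBval : ∫ p in Ioi (0 : ℝ) ×ˢ Ioo (-Real.pi) Real.pi, B p ∂(volume.prod volume) = 0 := by
    rw [IntegrableOn, ← Measure.prod_restrict] at hBi
    rw [← Measure.prod_restrict]
    rw [integral_prod _ hBi]
    refine setIntegral_eq_zero_of_forall_eq_zero fun r hr => ?_
    have hr' : (r : ℂ) ≠ 0 := by exact_mod_cast (ne_of_gt hr)
    have hd : ∀ θ, HasDerivAt (fun θ : ℝ => (r : ℂ)⁻¹ * φ (r * e θ)) (B (r, θ)) θ := fun θ => by
      have h1 : HasDerivAt (fun θ : ℝ => (r : ℂ) * e θ) (r * (Complex.I * e θ)) θ :=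
        (hde θ).const_mul _
      have h2 := (((hφ.differentiable one_ne_zero) (r * e θ)).hasFDerivAt.comp_hasDerivAt θ
        h1).const_mul (r : ℂ)⁻¹
      convert! h2 using 1
      have : (r : ℂ) * (Complex.I * e θ) = r • (Complex.I * e θ) := by simp
      rw [this, map_smul, Complex.real_smul, ← mul_assoc, inv_mul_cancel₀ hr', one_mul]
    rw [← integral_Ioc_eq_integral_Ioo,
      ← intervalIntegral.integral_of_le (by linarith [Real.pi_pos]),
      intervalIntegral.integral_eq_sub_of_hasDerivAt (fun θ _ => hd θ)]
    · simp [he]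
    · refine Continuous.intervalIntegrable ?_ _ _
      simp only [hB]; fun_prop
  rw [hAval, hBval]
  push_cast
  ring

/-! ### The Cauchy transform with parameters -/

section CauchyTransform

variable {X : Type*}

/-- The Cauchy transform in the last variable of a function on `X × ℂ`, written as a convolution
with the fundamental solution `1 / (π t)` of `∂/∂w̄`. -/
def cauchyTransform (h : X × ℂ → ℂ) (p : X × ℂ) : ℂ :=
  ∫ t : ℂ, ((Real.pi : ℂ)⁻¹ * t⁻¹) * h (p.1, p.2 - t)

lemma cauchyTransform_eq_convolution (h : X × ℂ → ℂ) (x : X) :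
    (fun w => cauchyTransform h (x, w)) =
      (convolution (fun t : ℂ => (Real.pi : ℂ)⁻¹ * t⁻¹) (fun w => h (x, w))
        (ContinuousLinearMap.mul ℝ ℂ) volume) := rfl

lemma cauchyTransform_eq_integral (h : X × ℂ → ℂ) (p : X × ℂ) :
    cauchyTransform h p = ∫ ζ : ℂ, ((Real.pi : ℂ)⁻¹ * (p.2 - ζ)⁻¹) * h (p.1, ζ) := by
  rw [← integral_sub_left_eq_self _ volume p.2]
  simp [cauchyTransform]

lemma cauchyTransform_eq_zero {h : X × ℂ → ℂ} {x : X} (hx : ∀ ζ, h (x, ζ) = 0) (w : ℂ) :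
    cauchyTransform h (x, w) = 0 := by
  simp [cauchyTransform, hx]

variable [NormedAddCommGroup X] [NormedSpace ℝ X]

/-- The operator `∂/∂w̄` in the last variable `w` of a function on `X × ℂ`. -/
def wirtinger (g : X × ℂ → ℂ) (p : X × ℂ) : ℂ :=
  (fderiv ℝ g p (0, 1) + Complex.I * fderiv ℝ g p (0, Complex.I)) / 2

/-- Derivatives in the direction of the last factor are derivatives on slices. -/
lemma fderiv_slice {g : X × ℂ → ℂ} {p : X × ℂ} (hg : DifferentiableAt ℝ g p) (v : ℂ) :
    fderiv ℝ g p (0, v) = fderiv ℝ (fun w => g (p.1, w)) p.2 v := by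
  have h1 : HasFDerivAt (fun w : ℂ => (p.1, w)) (ContinuousLinearMap.inr ℝ X ℂ) p.2 :=
    hasFDerivAt_prodMk_right p.1 p.2
  have h2 : HasFDerivAt (fun w => g (p.1, w)) ((fderiv ℝ g p).comp (.inr ℝ X ℂ)) p.2 :=
    HasFDerivAt.comp p.2 (f := fun w : ℂ => (p.1, w)) (g := g) hg.hasFDerivAt h1
  rw [h2.fderiv]; rfl

lemma locallyIntegrable_cauchyKernel :
    LocallyIntegrable (fun t : ℂ => (Real.pi : ℂ)⁻¹ * t⁻¹) := by
  exact locallyIntegrable_inv.smul (Real.pi : ℂ)⁻¹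

lemma contDiff_cauchyTransform {h : X × ℂ → ℂ} (hh : ContDiff ℝ ∞ h) {R : ℝ}
    (hR : ∀ x ζ, R < ‖ζ‖ → h (x, ζ) = 0) : ContDiff ℝ ∞ (cauchyTransform h) := by
  rw [← contDiffOn_univ, ← univ_prod_univ]
  refine contDiffOn_convolution_right_with_param (n := ⊤) (ContinuousLinearMap.mul ℝ ℂ)
    (g := fun x w => h (x, w)) (k := Metric.closedBall 0 R) isOpen_univ
    (isCompact_closedBall 0 R) ?_ locallyIntegrable_cauchyKernel ?_
  · intro x ζ _ hζ
    exact hR x ζ (by simpa using hζ)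
  · exact hh.contDiffOn

/-- The Cauchy transform inverts `∂/∂w̄` on functions of bounded support in `w`. -/
lemma wirtinger_cauchyTransform {h : X × ℂ → ℂ} (hh : ContDiff ℝ ∞ h) {R : ℝ}
    (hR : ∀ x ζ, R < ‖ζ‖ → h (x, ζ) = 0) (p : X × ℂ) :
    wirtinger (cauchyTransform h) p = h p := by
  obtain ⟨x, w⟩ := p
  have hd : DifferentiableAt ℝ (cauchyTransform h) (x, w) :=
    (contDiff_cauchyTransform hh hR).differentiable (by simp) _
  have hs : ContDiff ℝ 1 fun ζ => h (x, ζ) :=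
    (hh.comp (contDiff_const.prodMk contDiff_id)).of_le (by simp)
  have hc : HasCompactSupport fun ζ => h (x, ζ) :=
    HasCompactSupport.intro (isCompact_closedBall (0 : ℂ) R) fun ζ hζ => hR x ζ (by simpa using hζ)
  have hD : ∀ v, fderiv ℝ (cauchyTransform h) (x, w) (0, v) =
      ∫ t : ℂ, ((Real.pi : ℂ)⁻¹ * t⁻¹) * fderiv ℝ (fun ζ => h (x, ζ)) (w - t) v := fun v => by
    rw [fderiv_slice hd, cauchyTransform_eq_convolution,
      (hc.hasFDerivAt_convolution_right _ locallyIntegrable_cauchyKernel hs w).fderiv,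
      convolution_precompR_apply _ locallyIntegrable_cauchyKernel (hc.fderiv ℝ)
        (hs.continuous_fderiv one_ne_zero)]
    rfl
  -- The claim is the Cauchy–Pompeiu formula for `t ↦ h (x, w - t)`.
  set φ : ℂ → ℂ := fun t => h (x, w - t) with hφ
  have hφs : ContDiff ℝ 1 φ := hs.comp (contDiff_const.sub contDiff_id)
  have hφc : HasCompactSupport φ := hc.comp_homeomorph (Homeomorph.subLeft w)
  have hφd : ∀ t v, fderiv ℝ φ t v = - fderiv ℝ (fun ζ => h (x, ζ)) (w - t) v := fun t v => by
    have h1 : HasFDerivAt (fun t : ℂ => w - t) (-ContinuousLinearMap.id ℝ ℂ) t :=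
      (hasFDerivAt_id t).const_sub w
    have h2 := HasFDerivAt.comp t ((hs.differentiable one_ne_zero) (w - t)).hasFDerivAt h1
    have h3 : fderiv ℝ φ t = _ := h2.fderiv
    rw [h3]; simp
  have hi : ∀ v, Integrable fun t : ℂ =>
      ((Real.pi : ℂ)⁻¹ * t⁻¹) * fderiv ℝ (fun ζ => h (x, ζ)) (w - t) v := fun v => by
    have hcv : HasCompactSupport fun ζ => fderiv ℝ (fun ζ => h (x, ζ)) ζ v :=
      (hc.fderiv ℝ).comp_left (g := fun L : ℂ →L[ℝ] ℂ => L v) rfl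
    have := (HasCompactSupport.convolutionExists_right (ContinuousLinearMap.mul ℝ ℂ) hcv
      locallyIntegrable_cauchyKernel
      ((hs.continuous_fderiv one_ne_zero).clm_apply continuous_const) w)
    exact this
  have key := cauchyPompeiu hφs hφc
  rw [wirtinger, hD, hD, ← integral_const_mul, ← integral_add (hi 1) ((hi _).const_mul _),
    ← integral_div]
  have e : ∀ t : ℂ, ((Real.pi : ℂ)⁻¹ * t⁻¹ * fderiv ℝ (fun ζ => h (x, ζ)) (w - t) 1 +
      Complex.I * ((Real.pi : ℂ)⁻¹ * t⁻¹ * fderiv ℝ (fun ζ => h (x, ζ)) (w - t) Complex.I)) / 2 =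
      (-(Real.pi : ℂ)⁻¹) *
        (t⁻¹ * ((fderiv ℝ φ t 1 + Complex.I * fderiv ℝ φ t Complex.I) / 2)) := fun t => by
    rw [hφd, hφd]; ring
  simp_rw [e]
  rw [integral_const_mul, key]
  have : (Real.pi : ℂ) ≠ 0 := by exact_mod_cast Real.pi_ne_zero
  simp only [hφ, sub_zero]
  field_simp

end CauchyTransform

/-! ### Derivatives of parametric integrals, of powers, and of series -/

section ParametricIntegral

variable {P G : Type*} [NormedAddCommGroup P] [NormedSpace ℝ P]
  [NormedAddCommGroup G] [NormedSpace ℝ G]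

set_option synthInstance.maxHeartbeats 200000 in
/-- For a smooth function of `(p, ζ)`, the iterated derivatives in `p` are smooth in `(p, ζ)`. -/
lemma contDiff_iteratedFDeriv_param {F : P → ℂ → G} (hF : ContDiff ℝ ∞ (Function.uncurry F))
    (k : ℕ) : ContDiff ℝ ∞ fun q : P × ℂ => iteratedFDeriv ℝ k (fun p => F p q.2) q.1 := by
  induction k with
  | zero =>
    simp only [iteratedFDeriv_zero_eq_comp]
    exact (continuousMultilinearCurryFin0 ℝ P G).symm.contDiff.comp hF
  | succ k ih =>
    have h : ContDiff ℝ ∞ fun q : P × ℂ =>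
        fderiv ℝ (iteratedFDeriv ℝ k fun p => F p q.2) q.1 :=
      ContDiff.fderiv (m := ∞) (f := fun (q : P × ℂ) p => iteratedFDeriv ℝ k (fun p => F p q.2) p)
        (g := Prod.fst) (ih.comp (contDiff_snd.prodMk (contDiff_snd.comp contDiff_fst)))
        contDiff_fst (by simp)
    exact (continuousMultilinearCurryLeftEquiv ℝ (fun _ : Fin (k + 1) => P)
      G).symm.toContinuousLinearEquiv.contDiff.comp h

variable [FiniteDimensional ℝ P]

/-- Differentiation under the integral sign, for integrands supported in a fixed compact set. -/
lemma hasFDerivAt_integral_of_contDiff {F : P → ℂ → G} (hF : ContDiff ℝ 1 (Function.uncurry F))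
    {K : Set ℂ} (hK : IsCompact K) (h0 : ∀ p ζ, ζ ∉ K → F p ζ = 0) (p : P) :
    HasFDerivAt (fun p => ∫ ζ, F p ζ) (∫ ζ, fderiv ℝ (fun p => F p ζ) p) p := by
  have hF' : Continuous fun q : P × ℂ => fderiv ℝ (fun p => F p q.2) q.1 :=
    (ContDiff.fderiv (n := 0) (m := 1) (f := fun (q : P × ℂ) p => F p q.2) (g := Prod.fst)
      (hF.comp (contDiff_snd.prodMk (contDiff_snd.comp contDiff_fst))) contDiff_fst
      (by simp)).continuous
  have hF'0 : ∀ p ζ, ζ ∉ K → fderiv ℝ (fun p => F p ζ) p = 0 := fun p ζ hζ => by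
    have : (fun p => F p ζ) = fun _ => 0 := funext fun p => h0 p ζ hζ
    rw [this]; simp
  obtain ⟨C, hC⟩ := ((isCompact_closedBall p 1).prod hK).exists_bound_of_continuousOn
    hF'.continuousOn
  have hsl : ∀ p, Continuous (F p) := fun p =>
    hF.continuous.comp (f := fun ζ : ℂ => (p, ζ)) (by fun_prop)
  have hcs : ∀ p, HasCompactSupport (F p) := fun p => HasCompactSupport.intro hK (h0 p)
  refine hasFDerivAt_integral_of_dominated_of_fderiv_le (s := Metric.closedBall p 1)
    (bound := K.indicator fun _ => C) (F' := fun p ζ => fderiv ℝ (fun p => F p ζ) p)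
    (Metric.closedBall_mem_nhds p one_pos) ?_ ?_ ?_ ?_ ?_ ?_
  · exact Filter.Eventually.of_forall fun p =>
      ((hsl p).integrable_of_hasCompactSupport (hcs p)).aestronglyMeasurable
  · exact (hsl p).integrable_of_hasCompactSupport (hcs p)
  · have h1 : Continuous fun ζ => fderiv ℝ (fun p => F p ζ) p :=
      hF'.comp (f := fun ζ : ℂ => (p, ζ)) (by fun_prop)
    exact (h1.integrable_of_hasCompactSupport
      (HasCompactSupport.intro hK (hF'0 p))).aestronglyMeasurable
  · refine Filter.Eventually.of_forall fun ζ p' hp' => ?_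
    by_cases hζ : ζ ∈ K
    · simpa [hζ] using hC (p', ζ) ⟨hp', hζ⟩
    · simp [hζ, hF'0 p' ζ hζ]
  · rw [integrable_indicator_iff hK.measurableSet]
    exact integrableOn_const hK.measure_lt_top.ne
  · refine Filter.Eventually.of_forall fun ζ p' _ => ?_
    have : Differentiable ℝ fun p => F p ζ :=
      (hF.comp (contDiff_id.prodMk contDiff_const)).differentiable one_ne_zero
    exact (this p').hasFDerivAt

set_option synthInstance.maxHeartbeats 200000 in
/-- Iterated differentiation under the integral sign. -/
lemma iteratedFDeriv_integral_of_contDiff {F : P → ℂ → G}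
    (hF : ContDiff ℝ ∞ (Function.uncurry F))
    {K : Set ℂ} (hK : IsCompact K) (h0 : ∀ p ζ, ζ ∉ K → F p ζ = 0) (k : ℕ) :
    iteratedFDeriv ℝ k (fun p => ∫ ζ, F p ζ) =
      fun p => ∫ ζ, iteratedFDeriv ℝ k (fun p => F p ζ) p := by
  induction k with
  | zero =>
    funext p
    simp only [iteratedFDeriv_zero_eq_comp, Function.comp]
    exact ((continuousMultilinearCurryFin0 ℝ
      P G).symm.toContinuousLinearEquiv.integral_comp_comm _).symm
  | succ k ih =>
    funext p
    rw [iteratedFDeriv_succ_eq_comp_left, ih]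
    simp only [iteratedFDeriv_succ_eq_comp_left, Function.comp]
    rw [(hasFDerivAt_integral_of_contDiff
      (F := fun p ζ => iteratedFDeriv ℝ k (fun p => F p ζ) p)
      ((contDiff_iteratedFDeriv_param hF k).of_le (by simp)) hK ?_ p).fderiv]
    · exact (ContinuousLinearEquiv.integral_comp_comm (𝕜 := ℝ) (E := P →L[ℝ] P [×k]→L[ℝ] G)
        (F := P [×(k + 1)]→L[ℝ] G) (μ := (volume : Measure ℂ))
        (continuousMultilinearCurryLeftEquiv ℝ
          (fun _ : Fin (k + 1) => P) G).symm.toContinuousLinearEquiv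
        (fun ζ => fderiv ℝ (iteratedFDeriv ℝ k fun p => F p ζ) p)).symm
    · intro p ζ hζ
      have : (fun p => F p ζ) = fun _ => 0 := funext fun p => h0 p ζ hζ
      rw [this, iteratedFDeriv_fun_zero]; rfl

lemma norm_iteratedFDeriv_integral_le {F : P → ℂ → G}
    (hF : ContDiff ℝ ∞ (Function.uncurry F))
    {K : Set ℂ} (hK : IsCompact K) (h0 : ∀ p ζ, ζ ∉ K → F p ζ = 0) {k : ℕ} {p : P} {M : ℝ}
    (hM : ∀ ζ ∈ K, ‖iteratedFDeriv ℝ k (fun p => F p ζ) p‖ ≤ M) :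
    ‖iteratedFDeriv ℝ k (fun p => ∫ ζ, F p ζ) p‖ ≤ M * (volume K).toReal := by
  rw [iteratedFDeriv_integral_of_contDiff hF hK h0]
  have h : ∫ ζ, iteratedFDeriv ℝ k (fun p => F p ζ) p =
      ∫ ζ in K, iteratedFDeriv ℝ k (fun p => F p ζ) p := by
    refine (setIntegral_eq_integral_of_forall_compl_eq_zero fun ζ hζ => ?_).symm
    have : (fun p => F p ζ) = fun _ => 0 := funext fun p => h0 p ζ hζ
    rw [this, iteratedFDeriv_fun_zero]; rfl
  simp only [h]
  exact norm_setIntegral_le_of_norm_le_const hK.measure_lt_top hM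

end ParametricIntegral

section PowerDecay

variable {P : Type*} [NormedAddCommGroup P] [NormedSpace ℝ P]

/-- Where `‖q‖ ≤ 1/2`, each derivative of `q ^ N * A` decays geometrically in `N`, with a constant
that depends only on bounds for the derivatives of `q` and `A`. The proof applies the Leibniz rule
to `q * (q ^ N * A)`; the rate `3/4` leaves room over `1/2` to absorb the terms of lower order. -/
lemma exists_norm_iteratedFDeriv_pow_mul_le (a b : ℝ) (ha : 0 ≤ a) (hb : 0 ≤ b) (k : ℕ) :
    ∃ C : ℝ, 0 ≤ C ∧ ∀ (q A : P → ℂ) (p : P), ContDiff ℝ ∞ q → ContDiff ℝ ∞ A → ‖q p‖ ≤ 1 / 2 →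
      (∀ i ≤ k, ‖iteratedFDeriv ℝ i q p‖ ≤ b) → (∀ i ≤ k, ‖iteratedFDeriv ℝ i A p‖ ≤ a) →
      ∀ N : ℕ, ‖iteratedFDeriv ℝ k (fun p => q p ^ N * A p) p‖ ≤ C * (3 / 4) ^ N := by
  induction k using Nat.strong_induction_on with
  | _ k ih =>
  choose! C hC0 hC using ih
  set D : ℝ := ∑ i ∈ Finset.range k, (k.choose (i + 1) : ℝ) * b * C (k - (i + 1)) with hD
  have hD0 : 0 ≤ D := Finset.sum_nonneg fun i hi => by
    have := hC0 (k - (i + 1)) (by have := Finset.mem_range.1 hi; omega)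
    positivity
  -- `4 * D` is the fixed point of the recursion `C ↦ (D + C / 2) / (3 / 4)` for the constant.
  refine ⟨a + 4 * D, by positivity, fun q A p hq hA hqp hqb hAa N => ?_⟩
  induction N with
  | zero => simpa using (hAa k le_rfl).trans (by linarith)
  | succ N ihN =>
    have e : (fun p => q p ^ (N + 1) * A p) = fun p => q p * (q p ^ N * A p) := by
      funext p; ring
    rw [e]
    refine (norm_iteratedFDeriv_mul_le (N := ∞) hq ((hq.pow N).mul hA) p
      (by exact_mod_cast le_top)).trans ?_
    rw [Finset.sum_range_succ']
    have h1 : ∑ i ∈ Finset.range k, (k.choose (i + 1) : ℝ) * ‖iteratedFDeriv ℝ (i + 1) q p‖ *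
        ‖iteratedFDeriv ℝ (k - (i + 1)) (fun p => q p ^ N * A p) p‖ ≤ D * (3 / 4) ^ N := by
      rw [hD, Finset.sum_mul]
      refine Finset.sum_le_sum fun i hi => ?_
      have hi' := Finset.mem_range.1 hi
      have h2 := hC (k - (i + 1)) (by omega) q A p hq hA hqp (fun j hj => hqb j (by omega))
        (fun j hj => hAa j (by omega)) N
      have h3 := hqb (i + 1) (by omega)
      rw [mul_assoc _ (C _)]
      gcongr
    have h4 : ((k.choose 0 : ℕ) : ℝ) * ‖iteratedFDeriv ℝ 0 q p‖ *
        ‖iteratedFDeriv ℝ (k - 0) (fun p => q p ^ N * A p) p‖ ≤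
        1 / 2 * ((a + 4 * D) * (3 / 4) ^ N) := by
      rw [norm_iteratedFDeriv_zero, Nat.choose_zero_right, Nat.cast_one, one_mul, Nat.sub_zero]
      gcongr
    refine (add_le_add h1 h4).trans ?_
    have : (0 : ℝ) ≤ (3 / 4) ^ N := by positivity
    rw [pow_succ]
    nlinarith [mul_nonneg ha this, mul_nonneg hD0 this]

end PowerDecay

section SmoothSeries

variable {P : Type*} [NormedAddCommGroup P] [NormedSpace ℝ P] [FiniteDimensional ℝ P]

/-- Termwise differentiation, under the bounds of `contDiff_tsum_of_norm_iteratedFDeriv_le`. -/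
lemma hasFDerivAt_tsum_of_norm_iteratedFDeriv_le {u : ℕ → P → ℂ} (hu : ∀ m, ContDiff ℝ ∞ (u m))
    (hb : ∀ m k : ℕ, k ≤ m → ∀ p, ‖p‖ ≤ m → ‖iteratedFDeriv ℝ k (u m) p‖ ≤ (1 / 2) ^ m) (p : P) :
    Summable (fun m => fderiv ℝ (u m) p) ∧
    HasFDerivAt (fun p => ∑' m, u m p) (∑' m, fderiv ℝ (u m) p) p := by
  obtain ⟨n, hn⟩ := exists_nat_gt (max ‖p‖ 1)
  have hball : ∀ m, n ≤ m → ∀ q ∈ Metric.ball (0 : P) n, ‖q‖ ≤ m := fun m hm q hq => by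
    rw [mem_ball_zero_iff] at hq
    exact hq.le.trans (by exact_mod_cast hm)
  have hn1 : 1 ≤ n := by exact_mod_cast ((le_max_right ‖p‖ 1).trans hn.le)
  have hp : p ∈ Metric.ball (0 : P) n := by
    rw [mem_ball_zero_iff]; exact (le_max_left ‖p‖ 1).trans_lt hn
  have hC : ∀ m, ∃ C, ∀ q ∈ Metric.closedBall (0 : P) n, ‖fderiv ℝ (u m) q‖ ≤ C := fun m =>
    (isCompact_closedBall _ _).exists_bound_of_continuousOn
      ((hu m).continuous_fderiv (by simp)).continuousOn
  choose C hC using hC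
  have hgeo : Summable fun m : ℕ => (1 / 2 : ℝ) ^ m := summable_geometric_two
  have hU : Summable fun m => if m < n then C m else (1 / 2 : ℝ) ^ m := by
    refine (summable_congr_cofinite ?_).1 hgeo
    rw [Nat.cofinite_eq_atTop]
    filter_upwards [Filter.eventually_ge_atTop n] with m hm
    simp [not_lt.2 hm]
  have hUb : ∀ m, ∀ q ∈ Metric.ball (0 : P) n,
      ‖fderiv ℝ (u m) q‖ ≤ if m < n then C m else (1 / 2 : ℝ) ^ m := fun m q hq => by
    split_ifs with h
    · exact hC m q (Metric.ball_subset_closedBall hq)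
    · rw [← norm_iteratedFDeriv_one]
      exact hb m 1 (by omega) q (hball m (not_lt.1 h) q hq)
  refine ⟨.of_norm_bounded hU fun m => hUb m p hp, ?_⟩
  refine hasFDerivAt_tsum_of_isPreconnected hU Metric.isOpen_ball
    (convex_ball _ _).isPreconnected
    (fun m q _ => ((hu m).differentiable (by simp) q).hasFDerivAt) hUb hp ?_ hp
  refine hgeo.of_norm_bounded_eventually_nat ?_
  filter_upwards [Filter.eventually_ge_atTop n] with m hm
  simpa using hb m 0 (by omega) p (hball m hm p hp)

/-- A series of smooth functions is smooth if its `m`-th term and the derivatives of that term of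
order at most `m` are bounded by `2 ^ (-m)` on the ball of radius `m`. The criterion in Mathlib asks
for bounds on the whole space, which are obtained by multiplication with a bump function. -/
lemma contDiff_tsum_of_norm_iteratedFDeriv_le {u : ℕ → P → ℂ} (hu : ∀ m, ContDiff ℝ ∞ (u m))
    (hb : ∀ m k : ℕ, k ≤ m → ∀ p, ‖p‖ ≤ m → ‖iteratedFDeriv ℝ k (u m) p‖ ≤ (1 / 2) ^ m) :
    ContDiff ℝ ∞ (fun p => ∑' m, u m p) := by
  rw [contDiff_iff_contDiffAt]
  intro p
  let ψ : ContDiffBump (0 : P) := ⟨‖p‖ + 1, ‖p‖ + 2, by positivity, by linarith⟩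
  have hψ : ContDiff ℝ ∞ (fun q => (ψ q : ℂ)) := Complex.ofRealCLM.contDiff.comp ψ.contDiff
  have hψ0 : ∀ q, ‖p‖ + 2 < ‖q‖ → (fun q => (ψ q : ℂ)) =ᶠ[𝓝 q] fun _ => 0 := fun q hq => by
    filter_upwards [(isOpen_lt continuous_const continuous_norm).mem_nhds hq] with r hr
    have : ψ r = 0 := ψ.zero_of_le_dist (by simpa using le_of_lt hr)
    simp [this]
  have hC : ∀ k, ∃ C, 0 ≤ C ∧ ∀ i ≤ k, ∀ q, ‖iteratedFDeriv ℝ i (fun q => (ψ q : ℂ)) q‖ ≤ C := by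
    have h1 : ∀ i, ∃ C, 0 ≤ C ∧ ∀ q, ‖iteratedFDeriv ℝ i (fun q => (ψ q : ℂ)) q‖ ≤ C := fun i => by
      obtain ⟨C, hC⟩ := (isCompact_closedBall (0 : P) (‖p‖ + 2)).exists_bound_of_continuousOn
        (hψ.continuous_iteratedFDeriv (m := i) (by exact_mod_cast le_top)).continuousOn
      refine ⟨max C 0, le_max_right _ _, fun q => ?_⟩
      by_cases hq : ‖q‖ ≤ ‖p‖ + 2
      · exact (hC q (by simpa using hq)).trans (le_max_left _ _)
      · rw [((hψ0 q (not_le.1 hq)).iteratedFDeriv ℝ i).eq_of_nhds, iteratedFDeriv_fun_zero]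
        simp
    choose C hC0 hC using h1
    intro k
    refine ⟨∑ i ∈ Finset.range (k + 1), C i, Finset.sum_nonneg fun i _ => hC0 i,
      fun i hi q => (hC i q).trans ?_⟩
    exact Finset.single_le_sum (f := C) (fun i _ => hC0 i) (Finset.mem_range.2 (by omega))
  choose C hC0 hC using hC
  have key : ContDiff ℝ ∞ fun q => ∑' m, (ψ q : ℂ) * u m q := by
    refine contDiff_tsum_of_eventually (N := ⊤)
      (v := fun k m => (∑ i ∈ Finset.range (k + 1), (k.choose i : ℝ) * C k) * (1 / 2 : ℝ) ^ m)
      (fun m => hψ.mul (hu m)) (fun k _ => summable_geometric_two.mul_left _) fun k _ => ?_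
    rw [Nat.cofinite_eq_atTop]
    obtain ⟨n, hn⟩ := exists_nat_gt (‖p‖ + 2)
    filter_upwards [Filter.eventually_ge_atTop n, Filter.eventually_ge_atTop k] with m hm hkm q
    by_cases hq : ‖q‖ ≤ ‖p‖ + 2
    · refine (norm_iteratedFDeriv_mul_le (N := ∞) hψ (hu m) q
        (by exact_mod_cast le_top)).trans ?_
      rw [Finset.sum_mul]
      refine Finset.sum_le_sum fun i hi => ?_
      have hi' := Finset.mem_range.1 hi
      have hqm : ‖q‖ ≤ m := hq.trans (hn.le.trans (by exact_mod_cast hm))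
      have h1 := hC k i (by omega) q
      have h2 := hb m (k - i) (by omega) q hqm
      have := hC0 k
      gcongr
    · have h0 : (fun q => (ψ q : ℂ) * u m q) =ᶠ[𝓝 q] fun _ => 0 := by
        filter_upwards [hψ0 q (not_le.1 hq)] with r hr
        simp [hr]
      rw [(h0.iteratedFDeriv ℝ k).eq_of_nhds, iteratedFDeriv_fun_zero]
      have : 0 ≤ ∑ i ∈ Finset.range (k + 1), (k.choose i : ℝ) * C k :=
        Finset.sum_nonneg fun i _ => mul_nonneg (by positivity) (hC0 k)
      simp only [Pi.zero_apply, norm_zero]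
      positivity
  refine key.contDiffAt.congr_of_eventuallyEq ?_
  have hp : p ∈ Metric.ball (0 : P) (‖p‖ + 1) := by simp
  filter_upwards [Metric.isOpen_ball.mem_nhds hp] with q hq
  have : ψ q = 1 := ψ.one_of_mem_closedBall (Metric.ball_subset_closedBall hq)
  simp [this]

end SmoothSeries

/-! ### The equation `∂g/∂w̄ = f` with parameters -/

section WirtingerEquation

variable {X : Type*} [NormedAddCommGroup X] [NormedSpace ℝ X]

/-- For `h` vanishing near the slice `ζ = 0`, the function `h (x, ζ) / ζ ^ N`. On that slice
`0⁻¹ = 0` and `h = 0`, so that its value is zero there for all `N`. -/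
def divPow (h : X × ℂ → ℂ) (N : ℕ) (p : X × ℂ) : ℂ := p.2⁻¹ ^ N * h p

lemma contDiff_divPow {h : X × ℂ → ℂ} (hh : ContDiff ℝ ∞ h)
    (h0 : ∀ x ζ, ‖ζ‖ < 1 → h (x, ζ) = 0) (N : ℕ) : ContDiff ℝ ∞ (divPow h N) := by
  rw [contDiff_iff_contDiffAt]
  rintro ⟨x, ζ⟩
  by_cases hζ : ζ = 0
  · have : divPow h N =ᶠ[𝓝 (x, ζ)] fun _ => 0 := by
      have ho : IsOpen {p : X × ℂ | ‖p.2‖ < 1} := isOpen_lt (by fun_prop) (by fun_prop)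
      filter_upwards [ho.mem_nhds (by simp [hζ])] with p hp
      simp [divPow, h0 p.1 p.2 hp]
    exact contDiffAt_const.congr_of_eventuallyEq this
  · exact ((contDiffAt_snd.inv hζ).pow N).mul hh.contDiffAt

/-- The integrand of the Cauchy transform of `h`, cut off by `ψ` away from the singularity. -/
def cutoffKernel (ψ : ContDiffBump (0 : ℂ)) (h : X × ℂ → ℂ) (p : X × ℂ) (ζ : ℂ) : ℂ :=
  (ψ p.2 : ℂ) * ((Real.pi : ℂ)⁻¹ * (p.2 - ζ)⁻¹) * h (p.1, ζ)

/-- The cut-off kernel is smooth if the supports of `ψ` and of `h` are separated, since then it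
vanishes near the diagonal `w = ζ`. -/
lemma contDiff_cutoffKernel {ψ : ContDiffBump (0 : ℂ)} {h : X × ℂ → ℂ} (hh : ContDiff ℝ ∞ h)
    {s : ℝ} (hs : ψ.rOut < s) (h0 : ∀ x ζ, ‖ζ‖ < s → h (x, ζ) = 0) :
    ContDiff ℝ ∞ (Function.uncurry (cutoffKernel ψ h)) := by
  rw [contDiff_iff_contDiffAt]
  rintro ⟨⟨x, w⟩, ζ⟩
  by_cases hw : w - ζ = 0
  · have : Function.uncurry (cutoffKernel ψ h) =ᶠ[𝓝 ((x, w), ζ)] fun _ => 0 := by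
      obtain h1 | h1 := lt_or_ge ‖ζ‖ s
      · have ho : IsOpen {q : (X × ℂ) × ℂ | ‖q.2‖ < s} := isOpen_lt (by fun_prop) (by fun_prop)
        filter_upwards [ho.mem_nhds h1] with q hq
        simp [Function.uncurry, cutoffKernel, h0 _ _ hq]
      · have ho : IsOpen {q : (X × ℂ) × ℂ | ψ.rOut < ‖q.1.2‖} :=
          isOpen_lt (by fun_prop) (by fun_prop)
        have hm : ψ.rOut < ‖w‖ := by rw [sub_eq_zero.1 hw]; linarith
        filter_upwards [ho.mem_nhds hm] with q hq
        have : ψ q.1.2 = 0 := ψ.zero_of_le_dist (by simpa using le_of_lt hq)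
        simp [Function.uncurry, cutoffKernel, this]
    exact contDiffAt_const.congr_of_eventuallyEq this
  · have h1 : ContDiffAt ℝ ∞ (fun q : (X × ℂ) × ℂ => q.1.2 - q.2) ((x, w), ζ) :=
      (contDiffAt_snd.comp _ contDiffAt_fst).sub contDiffAt_snd
    have h2 : ContDiff ℝ ∞ (fun q : (X × ℂ) × ℂ => (ψ q.1.2 : ℂ)) :=
      Complex.ofRealCLM.contDiff.comp (ψ.contDiff.comp (contDiff_snd.comp contDiff_fst))
    have h3 : ContDiff ℝ ∞ (fun q : (X × ℂ) × ℂ => h (q.1.1, q.2)) :=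
      hh.comp ((contDiff_fst.comp contDiff_fst).prodMk contDiff_snd)
    exact (h2.contDiffAt.mul (contDiffAt_const.mul (h1.inv hw))).mul h3.contDiffAt

/-- Multiplication by a power of `w`, which is holomorphic, commutes with `∂/∂w̄`. -/
lemma wirtinger_pow_mul {N : ℕ} {g : X × ℂ → ℂ} {p : X × ℂ} (hg : DifferentiableAt ℝ g p) :
    wirtinger (fun p => p.2 ^ N * g p) p = p.2 ^ N * wirtinger g p := by
  have h1 : HasFDerivAt (fun p : X × ℂ => p.2 ^ N)
      ((((N : ℂ) * p.2 ^ (N - 1)) • ContinuousLinearMap.id ℝ ℂ).comp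
        (ContinuousLinearMap.snd ℝ X ℂ)) p := by
    have := ((hasDerivAt_pow N p.2).hasFDerivAt.restrictScalars ℝ).comp p
      (hasFDerivAt_snd (𝕜 := ℝ) (E := X) (F := ℂ))
    convert! this using 1
    ext v <;> simp [mul_comm]
  have h2 := (h1.mul hg.hasFDerivAt).fderiv
  have h3 : fderiv ℝ (fun p : X × ℂ => p.2 ^ N * g p) p = _ := h2
  rw [wirtinger, h3, wirtinger]
  simp
  linear_combination (g p * N * p.2 ^ (N - 1)) * Complex.I_mul_I / 2

variable [FiniteDimensional ℝ X]

/-- If `h` vanishes for `|ζ| < 2r + 1`, the functions `w ^ N * C (h / ζ ^ N)`, where `C` is the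
Cauchy transform, tend to zero on the ball of radius `r` with all their derivatives: there they
are integrals of `(w / ζ) ^ N` against a smooth kernel, and `|w / ζ| ≤ 1 / 2`. -/
lemma eventually_norm_iteratedFDeriv_pow_mul_cauchyTransform_le {h : X × ℂ → ℂ}
    (hh : ContDiff ℝ ∞ h) {r R : ℝ} (hr : 0 ≤ r) (h0 : ∀ x ζ, ‖ζ‖ < 2 * r + 1 → h (x, ζ) = 0)
    (hR : ∀ x ζ, R < ‖ζ‖ → h (x, ζ) = 0) (k : ℕ) {ε : ℝ} (hε : 0 < ε) :
    ∀ᶠ N : ℕ in Filter.atTop, ∀ p : X × ℂ, ‖p‖ ≤ r →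
      ‖iteratedFDeriv ℝ k (fun p => p.2 ^ N * cauchyTransform (divPow h N) p) p‖ ≤ ε := by
  let ψ : ContDiffBump (0 : ℂ) := ⟨r + 1 / 8, r + 1 / 4, by positivity, by linarith⟩
  have hψ : ψ.rOut < 2 * r + 1 := by change r + 1 / 4 < 2 * r + 1; linarith
  have hA := contDiff_cutoffKernel hh hψ h0
  have hK : IsCompact (Metric.closedBall (0 : ℂ) R) := isCompact_closedBall _ _
  have hBall : IsCompact (Metric.closedBall (0 : X × ℂ) r) := isCompact_closedBall _ _
  have ha : ∃ a, 0 ≤ a ∧ ∀ i ≤ k, ∀ p : X × ℂ, ‖p‖ ≤ r → ∀ ζ, ‖ζ‖ ≤ R →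
      ‖iteratedFDeriv ℝ i (fun p => cutoffKernel ψ h p ζ) p‖ ≤ a := by
    have h1 : ∀ i, ∃ a, 0 ≤ a ∧ ∀ p : X × ℂ, ‖p‖ ≤ r → ∀ ζ, ‖ζ‖ ≤ R →
        ‖iteratedFDeriv ℝ i (fun p => cutoffKernel ψ h p ζ) p‖ ≤ a := fun i => by
      obtain ⟨a, ha⟩ := (hBall.prod hK).exists_bound_of_continuousOn
        (contDiff_iteratedFDeriv_param hA i).continuous.continuousOn
      exact ⟨max a 0, le_max_right _ _, fun p hp ζ hζ =>
        (ha (p, ζ) ⟨by simpa using hp, by simpa using hζ⟩).trans (le_max_left _ _)⟩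
    choose a ha0 ha using h1
    refine ⟨∑ i ∈ Finset.range (k + 1), a i, Finset.sum_nonneg fun i _ => ha0 i,
      fun i hi p hp ζ hζ => (ha i p hp ζ hζ).trans ?_⟩
    exact Finset.single_le_sum (f := a) (fun i _ => ha0 i) (Finset.mem_range.2 (by omega))
  obtain ⟨a, ha0, ha⟩ := ha
  have hb : ∃ b, 0 ≤ b ∧ ∀ i ≤ k, ∀ p : X × ℂ, ‖p‖ ≤ r →
      ‖iteratedFDeriv ℝ i (fun p : X × ℂ => p.2) p‖ ≤ b := by
    have h1 : ∀ i, ∃ b, 0 ≤ b ∧ ∀ p : X × ℂ, ‖p‖ ≤ r →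
        ‖iteratedFDeriv ℝ i (fun p : X × ℂ => p.2) p‖ ≤ b := fun i => by
      obtain ⟨a, ha⟩ := hBall.exists_bound_of_continuousOn
        ((contDiff_snd (𝕜 := ℝ) (n := ∞) (E := X) (F := ℂ)).continuous_iteratedFDeriv (m := i)
          (by exact_mod_cast le_top)).continuousOn
      exact ⟨max a 0, le_max_right _ _, fun p hp =>
        (ha p (by simpa using hp)).trans (le_max_left _ _)⟩
    choose b hb0 hb using h1
    refine ⟨∑ i ∈ Finset.range (k + 1), b i, Finset.sum_nonneg fun i _ => hb0 i,
      fun i hi p hp => (hb i p hp).trans ?_⟩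
    exact Finset.single_le_sum (f := b) (fun i _ => hb0 i) (Finset.mem_range.2 (by omega))
  obtain ⟨b, hb0, hb⟩ := hb
  obtain ⟨C, hC0, hC⟩ := exists_norm_iteratedFDeriv_pow_mul_le (P := X × ℂ) a b ha0 hb0 k
  have hlim : Filter.Tendsto
      (fun N : ℕ => C * (3 / 4 : ℝ) ^ N * (volume (Metric.closedBall (0 : ℂ) R)).toReal)
      Filter.atTop (𝓝 0) := by
    simpa using ((tendsto_pow_atTop_nhds_zero_of_lt_one (r := (3 / 4 : ℝ)) (by norm_num)
      (by norm_num)).const_mul C).mul_const (volume (Metric.closedBall (0 : ℂ) R)).toReal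
  filter_upwards [hlim.eventually_lt_const hε] with N hN p hp
  have hdiv := contDiff_divPow hh (fun x ζ hζ => h0 x ζ (by linarith)) N
  have hdiv0 : ∀ x ζ, ‖ζ‖ < 2 * r + 1 → divPow h N (x, ζ) = 0 := fun x ζ hζ => by
    simp [divPow, h0 x ζ hζ]
  have hev : (fun p : X × ℂ => p.2 ^ N * cauchyTransform (divPow h N) p) =ᶠ[𝓝 p]
      fun p => ∫ ζ, p.2 ^ N * cutoffKernel ψ (divPow h N) p ζ := by
    have ho : IsOpen {q : X × ℂ | ‖q.2‖ < r + 1 / 8} := isOpen_lt (by fun_prop) (by fun_prop)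
    have hm : ‖p.2‖ < r + 1 / 8 := (norm_snd_le p).trans_lt (by linarith)
    filter_upwards [ho.mem_nhds hm] with q hq
    have : ψ q.2 = 1 := ψ.one_of_mem_closedBall (mem_closedBall_zero_iff.2 (le_of_lt hq))
    rw [cauchyTransform_eq_integral, ← integral_const_mul]
    simp [cutoffKernel, this]
  rw [(hev.iteratedFDeriv ℝ k).eq_of_nhds]
  refine (norm_iteratedFDeriv_integral_le
    (F := fun p ζ => p.2 ^ N * cutoffKernel ψ (divPow h N) p ζ)
    (((contDiff_snd.comp contDiff_fst).pow N).mul (contDiff_cutoffKernel hdiv hψ hdiv0)) hK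
    ?_ (M := C * (3 / 4) ^ N) ?_).trans hN.le
  · intro p ζ hζ
    have : R < ‖ζ‖ := by simpa using hζ
    simp [cutoffKernel, divPow, hR _ _ this]
  · intro ζ hζ
    obtain h1 | h1 := lt_or_ge ‖ζ‖ (2 * r + 1)
    · have : (fun p : X × ℂ => p.2 ^ N * cutoffKernel ψ (divPow h N) p ζ) = fun _ => 0 := by
        funext q; simp [cutoffKernel, hdiv0 _ _ h1]
      rw [this, iteratedFDeriv_fun_zero]
      simp only [Pi.zero_apply, norm_zero]
      positivity
    · have hζ1 : ‖ζ⁻¹‖ ≤ 1 := by rw [norm_inv]; exact inv_le_one_of_one_le₀ (by linarith)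
      have e : (fun p : X × ℂ => p.2 ^ N * cutoffKernel ψ (divPow h N) p ζ) =
          fun p => (ζ⁻¹ • p.2) ^ N * cutoffKernel ψ h p ζ := by
        funext q; simp only [cutoffKernel, divPow, smul_eq_mul, mul_pow]; ring
      rw [e]
      have hqs : ContDiff ℝ ∞ fun p : X × ℂ => ζ⁻¹ • p.2 := by fun_prop
      have hAζ : ContDiff ℝ ∞ fun p : X × ℂ => cutoffKernel ψ h p ζ :=
        hA.comp (f := fun p : X × ℂ => (p, ζ)) (contDiff_id.prodMk contDiff_const)
      refine hC (fun p => ζ⁻¹ • p.2) (fun p => cutoffKernel ψ h p ζ) p hqs hAζ ?_ ?_ ?_ N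
      · have : ‖p.2‖ ≤ r := (norm_snd_le p).trans hp
        rw [norm_smul, norm_inv, inv_mul_le_iff₀ (by linarith)]
        linarith
      · intro i hi
        have h2 : iteratedFDeriv ℝ i (fun p : X × ℂ => ζ⁻¹ • p.2) p =
            ζ⁻¹ • iteratedFDeriv ℝ i (fun p : X × ℂ => p.2) p :=
          iteratedFDeriv_const_smul_apply' contDiff_snd.contDiffAt
        rw [h2, norm_smul]
        exact (mul_le_of_le_one_left (norm_nonneg _) hζ1).trans (hb i hi p hp)
      · exact fun i hi => ha i hi p hp ζ (by simpa using hζ)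

/-- Every smooth right-hand side is a `∂/∂w̄`-derivative on `X × ℂ`, and the solution may be chosen
smooth and zero on each line `{x} × ℂ` on which the right-hand side is zero. -/
theorem exists_wirtinger_eq {f : X × ℂ → ℂ} (hf : ContDiff ℝ ∞ f) :
    ∃ g : X × ℂ → ℂ, ContDiff ℝ ∞ g ∧ (∀ p, wirtinger g p = f p) ∧
      ∀ x, (∀ w, f (x, w) = 0) → ∀ w, g (x, w) = 0 := by
  -- `f` is the sum of `f₀ = χ₀ f` and the functions `hₘ = (χₘ₊₁ - χₘ) f`, which are supported in
  -- annuli. The radii leave room for the factor `1 / 2` between `|w| ≤ m` and `|ζ| ≥ 2 m + 1`.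
  let χ : ℕ → ContDiffBump (0 : ℂ) := fun m =>
    ⟨2 * m + 1, 2 * m + 2, by positivity, by linarith⟩
  have hχs : ∀ m, ContDiff ℝ ∞ fun p : X × ℂ => (χ m p.2 : ℂ) := fun m =>
    Complex.ofRealCLM.contDiff.comp ((χ m).contDiff.comp contDiff_snd)
  have hχ1 : ∀ (m : ℕ) (ζ : ℂ), ‖ζ‖ ≤ 2 * m + 1 → χ m ζ = 1 := fun m ζ hζ =>
    (χ m).one_of_mem_closedBall (by simpa using hζ)
  have hχ0 : ∀ (m : ℕ) (ζ : ℂ), 2 * (m : ℝ) + 2 ≤ ‖ζ‖ → χ m ζ = 0 := fun m ζ hζ =>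
    (χ m).zero_of_le_dist (by simpa using hζ)
  set h : ℕ → X × ℂ → ℂ := fun m p => ((χ (m + 1) p.2 : ℂ) - χ m p.2) * f p with hh
  have hhs : ∀ m, ContDiff ℝ ∞ (h m) := fun m => ((hχs (m + 1)).sub (hχs m)).mul hf
  have hh0 : ∀ (m : ℕ) x (ζ : ℂ), ‖ζ‖ < 2 * m + 1 → h m (x, ζ) = 0 := fun m x ζ hζ => by
    have h1 := hχ1 m ζ hζ.le
    have h2 := hχ1 (m + 1) ζ (by push_cast; linarith)
    simp [hh, h1, h2]
  have hhR : ∀ (m : ℕ) x (ζ : ℂ), 2 * (m : ℝ) + 4 < ‖ζ‖ → h m (x, ζ) = 0 := fun m x ζ hζ => by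
    have h1 := hχ0 m ζ (by linarith)
    have h2 := hχ0 (m + 1) ζ (by push_cast; linarith)
    simp [hh, h1, h2]
  have hN : ∀ m : ℕ, ∃ N : ℕ, ∀ k ≤ m, ∀ p : X × ℂ, ‖p‖ ≤ m →
      ‖iteratedFDeriv ℝ k (fun p => p.2 ^ N * cauchyTransform (divPow (h m) N) p) p‖
        ≤ (1 / 2) ^ m := fun m => by
    have := (Filter.eventually_all_finset (Finset.range (m + 1))).2 fun k _ =>
      eventually_norm_iteratedFDeriv_pow_mul_cauchyTransform_le (hhs m) (Nat.cast_nonneg m)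
        (hh0 m) (hhR m) k (ε := (1 / 2) ^ m) (by positivity)
    obtain ⟨N, hN⟩ := this.exists
    exact ⟨N, fun k hk => hN k (Finset.mem_range.2 (by omega))⟩
  choose N hN using hN
  set u : ℕ → X × ℂ → ℂ := fun m p => p.2 ^ N m * cauchyTransform (divPow (h m) (N m)) p with hu
  have hds : ∀ m, ContDiff ℝ ∞ (divPow (h m) (N m)) := fun m =>
    contDiff_divPow (hhs m) (fun x ζ hζ => hh0 m x ζ
      (by have : (0 : ℝ) ≤ m := Nat.cast_nonneg m; linarith)) _
  have hdR : ∀ (m : ℕ) x (ζ : ℂ), 2 * (m : ℝ) + 4 < ‖ζ‖ → divPow (h m) (N m) (x, ζ) = 0 :=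
    fun m x ζ hζ => by simp [divPow, hhR m x ζ hζ]
  have hcs : ∀ m, ContDiff ℝ ∞ (cauchyTransform (divPow (h m) (N m))) := fun m =>
    contDiff_cauchyTransform (hds m) (hdR m)
  have hus : ∀ m, ContDiff ℝ ∞ (u m) := fun m => (contDiff_snd.pow _).mul (hcs m)
  have huw : ∀ m p, wirtinger (u m) p = h m p := fun m p => by
    rw [hu, wirtinger_pow_mul ((hcs m).differentiable (by simp) p),
      wirtinger_cauchyTransform (hds m) (hdR m), divPow]
    by_cases hp : p.2 = 0
    · have : h m p = 0 := hh0 m p.1 p.2 (by simp [hp]; positivity)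
      rw [this]; simp
    · rw [← mul_assoc, ← mul_pow, mul_inv_cancel₀ hp, one_pow, one_mul]
  set f₀ : X × ℂ → ℂ := fun p => (χ 0 p.2 : ℂ) * f p with hf₀
  have hf₀s : ContDiff ℝ ∞ f₀ := (hχs 0).mul hf
  have hf₀R : ∀ x (ζ : ℂ), 2 < ‖ζ‖ → f₀ (x, ζ) = 0 := fun x ζ hζ => by
    simp [hf₀, hχ0 0 ζ (by simpa using hζ.le)]
  have hg₀ := contDiff_cauchyTransform hf₀s hf₀R
  refine ⟨fun p => cauchyTransform f₀ p + ∑' m, u m p,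
    hg₀.add (contDiff_tsum_of_norm_iteratedFDeriv_le hus fun m k hk => hN m k hk), fun p => ?_,
    fun x hx w => ?_⟩
  · obtain ⟨hsum, hder⟩ :=
      hasFDerivAt_tsum_of_norm_iteratedFDeriv_le hus (fun m k hk => hN m k hk) p
    have hd : fderiv ℝ (fun p => cauchyTransform f₀ p + ∑' m, u m p) p = _ :=
      ((hg₀.differentiable (by simp) p).hasFDerivAt.add hder).fderiv
    have happ : ∀ v, HasSum (fun m => fderiv ℝ (u m) p v) ((∑' m, fderiv ℝ (u m) p) v) := fun v =>
      hsum.hasSum.mapL (ContinuousLinearMap.apply ℝ ℂ v)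
    have h1 : HasSum (fun m => h m p) (((∑' m, fderiv ℝ (u m) p) (0, 1) +
        Complex.I * (∑' m, fderiv ℝ (u m) p) (0, Complex.I)) / 2) := by
      have := ((happ (0, 1)).add ((happ (0, Complex.I)).mul_left Complex.I)).div_const 2
      refine this.congr_fun fun m => ?_
      exact (huw m p).symm
    -- At a given point, only finitely many `hₘ` are nonzero, and their sum telescopes.
    obtain ⟨M, hM⟩ := exists_nat_gt ‖p.2‖
    have h2 : HasSum (fun m => h m p) (f p - f₀ p) := by
      have h3 : ∀ m ∉ Finset.range M, h m p = 0 := fun m hm => by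
        have : (M : ℝ) ≤ m := by exact_mod_cast not_lt.1 (fun h => hm (Finset.mem_range.2 h))
        exact hh0 m p.1 p.2 (by have := norm_nonneg p.2; linarith)
      have h4 : HasSum (fun m => h m p) (∑ m ∈ Finset.range M, h m p) :=
        hasSum_sum_of_ne_finset_zero h3
      have h5 : ∑ m ∈ Finset.range M, h m p = f p - f₀ p := by
        simp only [hh, ← Finset.sum_mul]
        rw [Finset.sum_range_sub (fun m => (χ m p.2 : ℂ)), hχ1 M p.2 (by
          have := norm_nonneg p.2; linarith)]
        simp only [hf₀]; push_cast; ring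
      rwa [h5] at h4
    have h6 := wirtinger_cauchyTransform hf₀s hf₀R p
    have h7 := h1.unique h2
    rw [wirtinger] at h6 ⊢
    rw [hd]
    simp only [add_apply]
    linear_combination h6 + h7
  · have h1 : cauchyTransform f₀ (x, w) = 0 :=
      cauchyTransform_eq_zero (fun ζ => by simp [hf₀, hx ζ]) w
    have h2 : ∀ m, u m (x, w) = 0 := fun m => by
      simp only [hu]
      rw [cauchyTransform_eq_zero (fun ζ => by simp [divPow, hh, hx ζ]) w, mul_zero]
    simp [h1, h2]

end WirtingerEquation

/-! ### Forms of type `(0,q)` on vector spaces and their pullbacks -/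

section TypeZeroForms

variable {E : Type*} [NormedAddCommGroup E] [NormedSpace ℂ E]

lemma IsType0.map_update_smul {q : ℕ} {θ : E [⋀^Fin q]→L[ℝ] ℂ} (hθ : IsType0 θ) (v : Fin q → E)
    (i : Fin q) (c : ℂ) (x : E) :
    θ (Function.update v i (c • x)) = (starRingEnd ℂ) c * θ (Function.update v i x) := by
  simpa using hθ (Function.update v i x) i c

/-- The complex conjugate of a form of type `(0,q)`, as a complex-multilinear alternating map. -/
def IsType0.conj {q : ℕ} {θ : E [⋀^Fin q]→L[ℝ] ℂ} (hθ : IsType0 θ) : E [⋀^Fin q]→ₗ[ℂ] ℂ where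
  toFun v := (starRingEnd ℂ) (θ v)
  map_update_add' {inst} v i x y := by
    rw [Subsingleton.elim inst (instDecidableEqFin q)]
    simp
  map_update_smul' {inst} v i c x := by
    rw [Subsingleton.elim inst (instDecidableEqFin q)]
    simp [hθ.map_update_smul]
  map_eq_zero_of_eq' v i j hv hij := by
    rw [θ.map_eq_zero_of_eq v hv hij, map_zero]

lemma IsType0.conj_apply {q : ℕ} {θ : E [⋀^Fin q]→L[ℝ] ℂ} (hθ : IsType0 θ) (v : Fin q → E) :
    hθ.conj v = (starRingEnd ℂ) (θ v) := rfl

lemma IsType0.map_smul {q : ℕ} {θ : E [⋀^Fin q]→L[ℝ] ℂ} (hθ : IsType0 θ) (c : ℂ)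
    (v : Fin q → E) : θ (fun i => c • v i) = (starRingEnd ℂ) c ^ q * θ v := by
  have h := hθ.conj.map_smul_univ (fun _ => c) v
  rw [hθ.conj_apply, hθ.conj_apply] at h
  have := congrArg (starRingEnd ℂ) h
  simpa using this

/-- Forms of type `(0,q)` in top degree are determined by their value on a basis. -/
lemma IsType0.ext_basis {q : ℕ} {θ θ' : E [⋀^Fin q]→L[ℝ] ℂ} (hθ : IsType0 θ) (hθ' : IsType0 θ')
    (b : Module.Basis (Fin q) ℂ E) (h : θ b = θ' b) : θ = θ' := by
  ext v
  have h1 : hθ.conj = hθ'.conj := by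
    rw [hθ.conj.eq_smul_basis_det b, hθ'.conj.eq_smul_basis_det b, hθ.conj_apply, hθ'.conj_apply, h]
  have h2 := congrArg (fun f => f v) h1
  simp only [IsType0.conj_apply] at h2
  exact (starRingEnd ℂ).injective h2

lemma IsType0.smul {q : ℕ} {θ : E [⋀^Fin q]→L[ℝ] ℂ} (hθ : IsType0 θ) (a : ℂ) :
    IsType0 (a • θ) := fun v i c => by
  simp [hθ v i c, mul_left_comm]

lemma IsType0.curryLeft {q : ℕ} {θ : E [⋀^Fin (q + 1)]→L[ℝ] ℂ} (hθ : IsType0 θ) (e : E) :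
    IsType0 (θ.curryLeft e) := fun v i c => by
  have := hθ (Matrix.vecCons e v) i.succ c
  simp only [ContinuousAlternatingMap.curryLeft_apply_apply]
  rw [← this]
  congr 1
  funext j
  refine Fin.cases ?_ (fun j => ?_) j
  · simp [Function.update, (Fin.succ_ne_zero i).symm]
  · simp [Function.update, Fin.succ_inj]

/-- A nonzero form of type `(0,q)` in top degree: the conjugate of a determinant. -/
lemma exists_isType0_apply_basis_eq_one {q : ℕ} (b : Module.Basis (Fin q) ℂ E) :
    ∃ κ : E [⋀^Fin q]→L[ℝ] ℂ, IsType0 κ ∧ κ b = 1 := by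
  have : FiniteDimensional ℂ E := b.finiteDimensional_of_finite
  have hc : Continuous fun v : Fin q → E => b.det v := by
    simp only [Module.Basis.det_apply]
    refine Continuous.matrix_det (continuous_matrix fun i j => ?_)
    simp only [Module.Basis.toMatrix_apply]
    exact (LinearMap.continuous_of_finiteDimensional (b.coord i)).comp (continuous_apply j)
  let ω₀ : E [⋀^Fin q]→L[ℂ] ℂ := { b.det with cont := hc }
  refine ⟨(Complex.conjCLE : ℂ →L[ℝ] ℂ).compContinuousAlternatingMap (ω₀.restrictScalars ℝ),
    fun v i c => ?_, ?_⟩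
  · have : ω₀ (Function.update v i (c • v i)) = c * ω₀ v := by
      rw [ω₀.map_update_smul]; simp
    simp [this]
  · have : ω₀ b = 1 := b.det_self
    simp [this]

lemma antilinearPart_apply {W : Type*} [NormedAddCommGroup W] [NormedSpace ℝ W] [NormedSpace ℂ W]
    [SMulCommClass ℝ ℂ W] (L : E →L[ℝ] W) (v : E) :
    antilinearPart L v = (1 / 2 : ℂ) • (L v + Complex.I • L (Complex.I • v)) := rfl

lemma antilinearPart_apply_smul (L : E →L[ℝ] ℂ) (c : ℂ) (v : E) :
    antilinearPart L (c • v) = (starRingEnd ℂ) c * antilinearPart L v := by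
  have h : ∀ (c : ℂ) (w : E), L (c • w) = c.re * L w + c.im * L (Complex.I • w) := fun c w => by
    have : c • w = c.re • w + c.im • (Complex.I • w) := by
      conv_lhs => rw [← Complex.re_add_im c, add_smul, mul_smul]
      simp
    rw [this, map_add, L.map_smul, L.map_smul]; simp
  rw [antilinearPart_apply, antilinearPart_apply, h c v, ← mul_smul, h (Complex.I * c) v]
  simp only [smul_eq_mul, Complex.mul_re, Complex.mul_im, Complex.I_re, Complex.I_im]
  have : (starRingEnd ℂ) c = c.re - c.im * Complex.I := by
    apply Complex.ext <;> simp
  rw [this]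
  push_cast
  linear_combination ((1 / 2 : ℂ) * c.im * L (Complex.I • v)) * Complex.I_mul_I

/-- If `L v` is of type `(0,q)` for all `v`, and conjugate-linear in `v`, then the
alternatization of `L` is of type `(0,q+1)`. -/
lemma isType0_alternatizeUncurryFin {q : ℕ} {L : E →L[ℝ] E [⋀^Fin q]→L[ℝ] ℂ}
    (hL : ∀ v, IsType0 (L v)) (hL' : ∀ (c : ℂ) v, L (c • v) = (starRingEnd ℂ) c • L v) :
    IsType0 (ContinuousAlternatingMap.alternatizeUncurryFin L) := fun v i c => by
  simp only [ContinuousAlternatingMap.alternatizeUncurryFin_apply, Finset.mul_sum]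
  refine Finset.sum_congr rfl fun j _ => ?_
  rw [mul_smul_comm]
  congr 1
  obtain rfl | ⟨k, rfl⟩ := Fin.eq_self_or_eq_succAbove j i
  · simp [hL']
  · rw [Function.update_of_ne (Fin.succAbove_ne j k).symm, ← Fin.removeNth_apply j v k,
      Fin.removeNth_update_succAbove]
    exact hL _ _ k c

lemma isType0_fderiv_apply {q : ℕ} {η : E → E [⋀^Fin q]→L[ℝ] ℂ} {z : E}
    (hη : DifferentiableAt ℝ η z) (h0 : ∀ z, IsType0 (η z)) (v : E) :
    IsType0 (fderiv ℝ η z v) := fun w i c => by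
  rw [← fderiv_continuousAlternatingMap_apply_const_apply hη,
    ← fderiv_continuousAlternatingMap_apply_const_apply hη]
  simp only [h0 _ w i c]
  have hd : DifferentiableAt ℝ (fun y => η y w) z :=
    hη.continuousAlternatingMap_apply fun _ => differentiableAt_const _
  have := (hd.hasFDerivAt.const_mul ((starRingEnd ℂ) c)).fderiv
  rw [this]; simp

/-- On forms of type `(0,q)`, the operator `∂̄` is the component of type `(0,q+1)` of the exterior
derivative, which is singled out by its behaviour under multiplication of all arguments by `i`. -/
lemma dbarLocal_apply_eq_extDeriv {q : ℕ} {η : E → E [⋀^Fin q]→L[ℝ] ℂ} {z : E}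
    (hη : DifferentiableAt ℝ η z) (h0 : ∀ z, IsType0 (η z)) (v : Fin (q + 1) → E) :
    dbarLocal η z v = (1 / 2 : ℂ) * (extDeriv η z v +
      Complex.I ^ (q + 1) * extDeriv η z fun i => Complex.I • v i) := by
  simp only [dbarLocal, extDeriv, ContinuousAlternatingMap.alternatizeUncurryFin_apply,
    Finset.mul_sum, ← Finset.sum_add_distrib]
  refine Finset.sum_congr rfl fun j _ => ?_
  have h1 : j.removeNth (fun i => Complex.I • v i) = fun i => Complex.I • j.removeNth v i := rfl
  rw [h1, (isType0_fderiv_apply hη h0 _).map_smul, antilinearPart_apply]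
  have h2 : Complex.I ^ (q + 1) * (starRingEnd ℂ) Complex.I ^ q = Complex.I := by
    rw [Complex.conj_I, pow_succ, mul_assoc, mul_comm Complex.I, ← mul_assoc, ← mul_pow]
    simp
  simp only [ContinuousAlternatingMap.smul_apply, ContinuousAlternatingMap.add_apply, smul_eq_mul,
    zsmul_eq_mul]
  push_cast
  rw [show ∀ a b c d : ℂ, a * (c * (b * d)) = c * ((a * b) * d) by intros; ring, h2]
  ring

variable {E' : Type*} [NormedAddCommGroup E'] [NormedSpace ℂ E']

lemma IsType0.compContinuousLinearMap {V V' : Type*} [AddCommGroup V] [Module ℂ V]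
    [TopologicalSpace V] [AddCommGroup V'] [Module ℂ V'] [TopologicalSpace V'] {q : ℕ}
    {θ : V' [⋀^Fin q]→L[ℝ] ℂ} (hθ : IsType0 θ) (A : V →L[ℂ] V') :
    IsType0 (θ.compContinuousLinearMap (A.restrictScalars ℝ)) := fun v i c => by
  have h : ∀ w : Fin q → V, (θ.compContinuousLinearMap (A.restrictScalars ℝ)) w
      = θ (fun j => A (w j)) := fun w => rfl
  rw [h, h]
  have h1 := hθ (fun j => A (v j)) i c
  rw [← h1]
  congr 1
  funext j
  by_cases hj : j = i
  · subst hj; simp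
  · simp [hj]

/-- The pullback of a field of forms under a complex-differentiable map. -/
def pullback {q : ℕ} (τ : E → E') (η : E' → E' [⋀^Fin q]→L[ℝ] ℂ) (z : E) : E [⋀^Fin q]→L[ℝ] ℂ :=
  (η (τ z)).compContinuousLinearMap ((fderiv ℂ τ z).restrictScalars ℝ)

lemma pullback_eventuallyEq {q : ℕ} {τ : E → E'} {η : E' → E' [⋀^Fin q]→L[ℝ] ℂ} {z : E}
    (hτ : ContDiffAt ℂ ω τ z) :
    pullback τ η =ᶠ[𝓝 z] fun z => (η (τ z)).compContinuousLinearMap (fderiv ℝ τ z) := by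
  filter_upwards [hτ.eventually (by simp)] with y hy
  rw [pullback, (hy.differentiableAt (by simp)).fderiv_restrictScalars ℝ]

lemma extDeriv_pullback_eq {q : ℕ} {τ : E → E'} {η : E' → E' [⋀^Fin q]→L[ℝ] ℂ} {z : E}
    (hτ : ContDiffAt ℂ ω τ z) (hη : DifferentiableAt ℝ η (τ z)) :
    extDeriv (pullback τ η) z = (extDeriv η (τ z)).compContinuousLinearMap
      ((fderiv ℂ τ z).restrictScalars ℝ) := by
  rw [(pullback_eventuallyEq hτ).extDeriv_eq, extDeriv_pullback hη (r := ω)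
    (hτ.restrict_scalars ℝ) (by simp),
    (hτ.differentiableAt (by simp)).fderiv_restrictScalars ℝ]

/-- The operator `∂̄` commutes with pullback under holomorphic maps. This follows from the same
property of the exterior derivative, because the derivative of a holomorphic map commutes with
multiplication by `i`. -/
lemma dbarLocal_pullback {q : ℕ} {τ : E → E'} {η : E' → E' [⋀^Fin q]→L[ℝ] ℂ} {z : E}
    (hτ : ContDiffAt ℂ ω τ z) (hη : DifferentiableAt ℝ η (τ z)) (h0 : ∀ z, IsType0 (η z)) :
    dbarLocal (pullback τ η) z = (dbarLocal η (τ z)).compContinuousLinearMap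
      ((fderiv ℂ τ z).restrictScalars ℝ) := by
  have hd : DifferentiableAt ℝ (pullback τ η) z := by
    have hτr : ContDiffAt ℝ 2 τ z := (hτ.restrict_scalars ℝ).of_le le_top
    exact ((hη.comp z
      (hτr.differentiableAt (by simp))).continuousAlternatingMapCompContinuousLinearMap
      ((hτr.fderiv_right (m := 1) (by norm_num)).differentiableAt (by simp))).congr_of_eventuallyEq
      (pullback_eventuallyEq hτ)
  ext v
  rw [dbarLocal_apply_eq_extDeriv hd (fun z => (h0 _).compContinuousLinearMap _),
    extDeriv_pullback_eq hτ hη]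
  have h1 : ∀ (θ : E' [⋀^Fin (q + 1)]→L[ℝ] ℂ) (w : Fin (q + 1) → E),
      θ.compContinuousLinearMap ((fderiv ℂ τ z).restrictScalars ℝ) w =
      θ (fun i => fderiv ℂ τ z (w i)) := fun _ _ => rfl
  rw [h1, h1, h1, dbarLocal_apply_eq_extDeriv hη h0]
  simp only [_root_.map_smul]

lemma finiteDimensional_continuousMultilinearMap (ι E : Type*) [Fintype ι] [NormedAddCommGroup E]
    [NormedSpace ℝ E] [FiniteDimensional ℝ E] :
    FiniteDimensional ℝ (ContinuousMultilinearMap ℝ (fun _ : ι => E) ℂ) :=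
  Module.Finite.of_injective
    (ContinuousMultilinearMap.toMultilinearMapLinear :
      ContinuousMultilinearMap ℝ (fun _ : ι => E) ℂ →ₗ[ℝ] MultilinearMap ℝ (fun _ : ι => E) ℂ)
    ContinuousMultilinearMap.toMultilinearMap_injective

/-- Composition of alternating maps with linear maps is smooth in both arguments. For multilinear
maps composition is itself a continuous multilinear operation; alternating maps are a direct
summand of them, by finite-dimensionality. -/
lemma contDiffAt_compContinuousLinearMap [FiniteDimensional ℂ E] {q : ℕ}
    {P : Type*} [NormedAddCommGroup P] [NormedSpace ℝ P]
    {f : P → E' [⋀^Fin q]→L[ℝ] ℂ} {g : P → E →L[ℝ] E'} {p : P}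
    (hf : ContDiffAt ℝ ∞ f p) (hg : ContDiffAt ℝ ∞ g p) :
    ContDiffAt ℝ ∞ (fun x => (f x).compContinuousLinearMap (g x)) p := by
  have : FiniteDimensional ℝ E := FiniteDimensional.complexToReal E
  have := finiteDimensional_continuousMultilinearMap (Fin q) E
  let i : (E [⋀^Fin q]→L[ℝ] ℂ) →L[ℝ] ContinuousMultilinearMap ℝ (fun _ : Fin q => E) ℂ :=
    ContinuousAlternatingMap.toContinuousMultilinearMapCLM ℝ
  let i' : (E' [⋀^Fin q]→L[ℝ] ℂ) →L[ℝ] ContinuousMultilinearMap ℝ (fun _ : Fin q => E') ℂ :=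
    ContinuousAlternatingMap.toContinuousMultilinearMapCLM ℝ
  obtain ⟨l, hl⟩ := i.toLinearMap.exists_leftInverse_of_injective
    (LinearMap.ker_eq_bot.2 fun _ _ h =>
    ContinuousAlternatingMap.toContinuousMultilinearMap_injective h)
  have h1 : ContDiffAt ℝ ∞ (fun x =>
      ContinuousMultilinearMap.compContinuousLinearMapContinuousMultilinear ℝ
        (fun _ : Fin q => E) (fun _ => E') ℂ (fun _ => g x) (i' (f x))) p := by
    refine ContDiffAt.clm_apply ?_ (i'.contDiff.contDiffAt.comp p hf)
    exact (ContinuousMultilinearMap.contDiff _).contDiffAt.comp p (contDiffAt_pi.2 fun _ => hg)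
  have h2 := (LinearMap.toContinuousLinearMap l).contDiff.contDiffAt.comp p h1
  refine h2.congr_of_eventuallyEq (Filter.Eventually.of_forall fun x => ?_)
  exact (LinearMap.congr_fun hl ((f x).compContinuousLinearMap (g x))).symm

lemma contDiffAt_pullback [FiniteDimensional ℂ E] {q : ℕ} {τ : E → E'}
    {η : E' → E' [⋀^Fin q]→L[ℝ] ℂ} {z : E}
    (hτ : ContDiffAt ℂ ω τ z) (hη : ContDiffAt ℝ ∞ η (τ z)) :
    ContDiffAt ℝ ∞ (pullback τ η) z := by
  have hτr : ContDiffAt ℝ ω τ z := hτ.restrict_scalars ℝ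
  refine (contDiffAt_compContinuousLinearMap (hη.comp z (hτr.of_le le_top))
    (hτr.fderiv_right (m := ∞) le_top)).congr_of_eventuallyEq (pullback_eventuallyEq hτ)

end TypeZeroForms

/-! ### Primitives of forms of top degree on a vector space -/

section LocalSolution

variable {E : Type*} [NormedAddCommGroup E] [NormedSpace ℂ E]

lemma exists_basis_apply_zero_eq {q : ℕ} [FiniteDimensional ℂ E]
    (hE : Module.finrank ℂ E = q + 1) {e : E} (he : e ≠ 0) :
    ∃ b : Module.Basis (Fin (q + 1)) ℂ E, b 0 = e := by
  let c := Module.finBasisOfFinrankEq ℂ E hE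
  obtain ⟨A, hA⟩ := SeparatingDual.exists_continuousLinearEquiv_apply_eq (R := ℂ) (c.ne_zero 0) he
  exact ⟨c.map A.toLinearEquiv, by simpa using hA⟩

/-- The equation `∂g/∂ē = f` in the direction of a nonzero vector `e`. -/
lemma exists_antilinearPart_fderiv_eq [FiniteDimensional ℂ E] {e : E} (he : e ≠ 0) {f : E → ℂ}
    (hf : ContDiff ℝ ∞ f) :
    ∃ g : E → ℂ, ContDiff ℝ ∞ g ∧ (∀ z, antilinearPart (fderiv ℝ g z) e = f z) ∧
      ∀ z, (∀ w : ℂ, f (z + w • e) = 0) → g z = 0 := by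
  have : FiniteDimensional ℝ E := FiniteDimensional.complexToReal E
  obtain ⟨l, hl⟩ := SeparatingDual.exists_eq_one (R := ℂ) he
  -- `A (x, w) = x + w • e` carries the last variable of `E × ℂ` to the direction `e`, and the
  -- linear functional `l` with `l e = 1` provides a section `B` of `A` with `B e = (0, 1)`.
  let A : E × ℂ →L[ℝ] E := (ContinuousLinearMap.fst ℂ E ℂ +
    (ContinuousLinearMap.snd ℂ E ℂ).smulRight e).restrictScalars ℝ
  have hA : ∀ p, A p = p.1 + p.2 • e := fun p => rfl
  let B : E →L[ℝ] E × ℂ :=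
    ((ContinuousLinearMap.id ℂ E - l.smulRight e).prod l).restrictScalars ℝ
  have hB : ∀ z, B z = (z - l z • e, l z) := fun z => rfl
  have hAB : ∀ z, A (B z) = z := fun z => by rw [hB, hA]; simp
  obtain ⟨g, hg, hgw, hg0⟩ := exists_wirtinger_eq (hf.comp A.contDiff)
  refine ⟨g ∘ B, hg.comp B.contDiff, fun z => ?_, fun z hz => ?_⟩
  · have h1 : fderiv ℝ (g ∘ B) z = (fderiv ℝ g (B z)).comp B :=
      ((hg.differentiable (by simp) (B z)).hasFDerivAt.comp z B.hasFDerivAt).fderiv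
    have h2 : ∀ c : ℂ, B (c • e) = (0, c) := fun c => by rw [hB]; simp [hl]
    have h3 := hgw (B z)
    have h4 : B e = (0, 1) := by simpa using h2 1
    rw [antilinearPart_apply, h1, ContinuousLinearMap.comp_apply, ContinuousLinearMap.comp_apply,
      h2, h4]
    rw [wirtinger] at h3
    simp only [Function.comp, hAB] at h3
    rw [← h3]
    simp only [smul_eq_mul]
    ring
  · refine hg0 _ (fun w => ?_) _
    have : A ((z - l z • e, l z).1, w) = z + (w - l z) • e := by
      rw [hA]; simp only [sub_smul]; abel
    change f (A ((z - l z • e, l z).1, w)) = 0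
    rw [this]
    exact hz _

/-- In top degree `∂̄θ = η` is solved by `θ = g ι_e κ`, where `κ` is a constant top-degree form
and `g` solves the scalar equation in the direction `e`: since `e` occurs in every basis
`(e, b₁, …)`, only the `e`-derivative of `g` contributes to `∂̄θ`. -/
theorem exists_dbarLocal_eq {q : ℕ} [FiniteDimensional ℂ E] (hE : Module.finrank ℂ E = q + 1)
    {e : E} (he : e ≠ 0) {η : E → E [⋀^Fin (q + 1)]→L[ℝ] ℂ} (hη : ContDiff ℝ ∞ η)
    (h0 : ∀ z, IsType0 (η z)) :
    ∃ θ : E → E [⋀^Fin q]→L[ℝ] ℂ, ContDiff ℝ ∞ θ ∧ (∀ z, IsType0 (θ z)) ∧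
      (∀ z, dbarLocal θ z = η z) ∧ ∀ z, (∀ w : ℂ, η (z + w • e) = 0) → θ z = 0 := by
  obtain ⟨b, rfl⟩ := exists_basis_apply_zero_eq hE he
  obtain ⟨κ, hκ, hκb⟩ := exists_isType0_apply_basis_eq_one b
  have hf : ContDiff ℝ ∞ fun z => η z b :=
    (ContinuousAlternatingMap.apply ℝ E ℂ b).contDiff.comp hη
  obtain ⟨g, hg, hge, hg0⟩ := exists_antilinearPart_fderiv_eq he hf
  set τ := κ.curryLeft (b 0) with hτ
  have hτ0 : IsType0 τ := hκ.curryLeft _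
  refine ⟨fun z => g z • τ, hg.smul contDiff_const, fun z => hτ0.smul _, fun z => ?_,
    fun z hz => ?_⟩
  · set a := antilinearPart (fderiv ℝ g z) with ha
    have h1 : ∀ v, antilinearPart (fderiv ℝ (fun z => g z • τ) z) v = a v • τ := fun v => by
      have : fderiv ℝ (fun z => g z • τ) z = (fderiv ℝ g z).smulRight τ :=
        ((hg.differentiable (by simp) z).hasFDerivAt.smul_const τ).fderiv
      rw [this, antilinearPart_apply, ha, antilinearPart_apply]
      ext w
      simp
      ring
    refine IsType0.ext_basis (isType0_alternatizeUncurryFin (fun v => ?_) fun c v => ?_)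
      (h0 z) b ?_
    · rw [h1]; exact hτ0.smul _
    · rw [h1, h1, ha, antilinearPart_apply_smul, mul_smul]
    · rw [dbarLocal, ContinuousAlternatingMap.alternatizeUncurryFin_apply, Fin.sum_univ_succ]
      simp only [h1, ContinuousAlternatingMap.smul_apply]
      -- If an argument other than `b 0` is removed, then `b 0` occurs twice in `κ`.
      have h2 : ∀ i : Fin q, τ (i.succ.removeNth b) = 0 := fun i => by
        rw [hτ, ContinuousAlternatingMap.curryLeft_apply_apply]
        have : NeZero q := ⟨i.pos.ne'⟩
        refine κ.map_eq_zero_of_eq _ (i := 0) (j := Fin.succ 0) ?_ (Fin.succ_ne_zero 0).symm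
        simp only [Matrix.cons_val_zero, Matrix.cons_val_succ, Fin.removeNth_apply]
        rw [Fin.succAbove_ne_zero_zero (Fin.succ_ne_zero i)]
      have h3 : τ ((0 : Fin (q + 1)).removeNth b) = 1 := by
        rw [hτ, ContinuousAlternatingMap.curryLeft_apply_apply, ← hκb]
        congr 1
        funext j
        refine Fin.cases ?_ (fun j => ?_) j <;> simp [Fin.tail]
      rw [h3]
      simp [h2, ha, hge]
  · simp [hg0 z fun w => by simp [hz w]]

end LocalSolution

/-! ### Primitives on manifolds -/

section ManifoldForms

variable {E : Type*} [NormedAddCommGroup E] [NormedSpace ℂ E]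
  {H : Type*} [TopologicalSpace H] {I : ModelWithCorners ℂ E H}
  {M : Type*} [TopologicalSpace M] [ChartedSpace H M]

lemma inChart_eventuallyEq {q : ℕ} {β γ : FormField I M q} {x₀ : M} {z : E}
    (hz : z ∈ (extChartAt I x₀).target) (h : ∀ᶠ y in 𝓝 ((extChartAt I x₀).symm z), β y = γ y) :
    β.inChart x₀ =ᶠ[𝓝 z] γ.inChart x₀ := by
  have := (continuousAt_extChartAt_symm'' hz).eventually h
  filter_upwards [this] with w hw
  rw [FormField.inChart, FormField.inChart, hw]

lemma FormField.sum_apply {q : ℕ} {ι : Type*} (s : Finset ι) (α : ι → FormField I M q) (x : M) :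
    (∑ i ∈ s, α i) x = ∑ i ∈ s, α i x := by
  classical
  induction s using Finset.induction_on with
  | empty => rfl
  | insert i s hi ih => rw [Finset.sum_insert hi, Finset.sum_insert hi, ← ih]; rfl

/-- The operator `∂̄` is local. -/
lemma dbar_congr {q : ℕ} {β γ : FormField I M q} {x : M} (h : ∀ᶠ y in 𝓝 x, β y = γ y) :
    β.dbar x = γ.dbar x := by
  have h1 : β.inChart x =ᶠ[𝓝 (extChartAt I x x)] γ.inChart x :=
    inChart_eventuallyEq (mem_extChartAt_target x) (by rwa [extChartAt_to_inv])
  rw [FormField.dbar, FormField.dbar, dbarLocal, dbarLocal, h1.fderiv_eq]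

variable [I.Boundaryless]

lemma dbar_sum {q : ℕ} {ι : Type*} (s : Finset ι) {α : ι → FormField I M q}
    (hα : ∀ i, α i ∈ forms I M q) : FormField.dbar (∑ i ∈ s, α i) = ∑ i ∈ s, (α i).dbar := by
  classical
  induction s using Finset.induction_on with
  | empty => simpa using dbar_zero
  | insert i s hi ih =>
    rw [Finset.sum_insert hi, Finset.sum_insert hi, dbar_add (hα i) (sum_mem fun i _ => hα i), ih]

/-- Locally finite sums of smooth primitives are smooth primitives. The hypothesis on `β` says that
`β x` is the sum of all `∂̄αᵢ` at `x`, in terms of arbitrary finite sets `s` of indices that contain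
those with `x ∈ Cᵢ`. -/
lemma exists_dbar_eq_of_locallyFinite {q : ℕ} {ι : Type*} {C : ι → Set M} (hC : LocallyFinite C)
    {α : ι → FormField I M q} (hα : ∀ i, α i ∈ forms I M q) (hα0 : ∀ i, ∀ x ∉ C i, α i x = 0)
    {β : FormField I M (q + 1)}
    (hβ : ∀ (x : M) (s : Finset ι), (∀ i, x ∈ C i → i ∈ s) → ∑ i ∈ s, (α i).dbar x = β x) :
    ∃ γ ∈ forms I M q, γ.dbar = β := by
  let γ : FormField I M q := fun x => ∑ᶠ i, α i x
  have key : ∀ x, ∃ s : Finset ι, (∀ i, x ∈ C i → i ∈ s) ∧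
      ∀ᶠ y in 𝓝 x, γ y = (∑ i ∈ s, α i) y := fun x => by
    obtain ⟨U, hU, hUf⟩ := hC x
    refine ⟨hUf.toFinset, fun i hi => ?_, ?_⟩
    · rw [Finite.mem_toFinset]
      exact ⟨x, hi, mem_of_mem_nhds hU⟩
    · filter_upwards [hU] with y hy
      rw [FormField.sum_apply]
      refine finsum_eq_sum_of_support_subset _ fun i hi => ?_
      rw [Finite.coe_toFinset]
      by_contra h
      exact hi (hα0 i y fun hyi => h ⟨y, hyi, hy⟩)
  refine ⟨γ, ⟨fun x => ?_, fun x₀ z hz => ?_⟩, funext fun x => ?_⟩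
  · obtain ⟨s, -, hs⟩ := key x
    rw [hs.self_of_nhds]
    exact (sum_mem fun i _ => hα i : ∑ i ∈ s, α i ∈ forms I M q).1 x
  · obtain ⟨s, -, hs⟩ := key ((extChartAt I x₀).symm z)
    have h1 : ∑ i ∈ s, α i ∈ forms I M q := sum_mem fun i _ => hα i
    have h2 := (h1.2 x₀).contDiffAt ((isOpen_extChartAt_target x₀).mem_nhds hz)
    exact (h2.congr_of_eventuallyEq (inChart_eventuallyEq hz hs)).contDiffWithinAt
  · obtain ⟨s, hs', hs⟩ := key x
    rw [dbar_congr hs, dbar_sum s hα, FormField.sum_apply, hβ x s hs']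

variable [IsManifold I ω M]

lemma contDiffAt_transition {x₀ x₁ : M} {z : E} (hz : z ∈ (extChartAt I x₀).target)
    (hz' : (extChartAt I x₀).symm z ∈ (extChartAt I x₁).source) :
    ContDiffAt ℂ ω (extChartAt I x₁ ∘ (extChartAt I x₀).symm) z := by
  have h := contDiffWithinAt_ext_coord_change (I := I) (n := ω) x₁ x₀ (y := z)
    (by rw [PartialEquiv.trans_source]; exact ⟨hz, hz'⟩)
  rwa [I.range_eq_univ, contDiffWithinAt_univ] at h

lemma mdifferentiableAt_extChartAt_symm {x₀ : M} {z : E} (hz : z ∈ (extChartAt I x₀).target) :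
    MDifferentiableAt 𝓘(ℂ, E) I (extChartAt I x₀).symm z := by
  have := mdifferentiableWithinAt_extChartAt_symm (I := I) hz
  rwa [I.range_eq_univ, mdifferentiableWithinAt_univ] at this

lemma fderiv_transition {x₀ x₁ : M} {z : E} (hz : z ∈ (extChartAt I x₀).target)
    (hz' : (extChartAt I x₀).symm z ∈ (extChartAt I x₁).source) :
    fderiv ℂ (extChartAt I x₁ ∘ (extChartAt I x₀).symm) z =
      (mfderiv I 𝓘(ℂ, E) (extChartAt I x₁) ((extChartAt I x₀).symm z)).comp
        (mfderiv 𝓘(ℂ, E) I (extChartAt I x₀).symm z) := by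
  rw [← mfderiv_eq_fderiv]
  exact mfderiv_comp z (mdifferentiableAt_extChartAt (by rwa [← extChartAt_source I x₁]))
    (mdifferentiableAt_extChartAt_symm hz)

/-- The derivative of the chart around `x₁` at `x`, read off through the chart around `x`. -/
lemma fderiv_transition_comp_mfderiv {x x₁ : M} (hx : x ∈ (extChartAt I x₁).source) :
    (fderiv ℂ (extChartAt I x₁ ∘ (extChartAt I x).symm) (extChartAt I x x)).comp
      (mfderiv I 𝓘(ℂ, E) (extChartAt I x) x) = mfderiv I 𝓘(ℂ, E) (extChartAt I x₁) x := by
  have h1 := contDiffAt_transition (mem_extChartAt_target (I := I) x)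
    (x₁ := x₁) (by rwa [extChartAt_to_inv])
  have h2 : MDifferentiableAt I 𝓘(ℂ, E) (extChartAt I x) x :=
    mdifferentiableAt_extChartAt (mem_chart_source H x)
  have h3 := mfderiv_comp x (h1.differentiableAt (by simp)).mdifferentiableAt h2
  rw [mfderiv_eq_fderiv] at h3
  refine h3.symm.trans (Filter.EventuallyEq.mfderiv_eq ?_)
  filter_upwards [extChartAt_source_mem_nhds (I := I) x] with y hy
  simp only [Function.comp]
  rw [(extChartAt I x).left_inv hy]

/-- A field of forms is recovered from its expression in any chart. -/
lemma inChart_apply_comp_mfderiv {q : ℕ} (β : FormField I M q) {x x₁ : M}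
    (hx : x ∈ (extChartAt I x₁).source) :
    (β.inChart x₁ (extChartAt I x₁ x)).compContinuousLinearMap
      ((mfderiv I 𝓘(ℂ, E) (extChartAt I x₁) x).restrictScalars ℝ) = β x := by
  have h1 : (mfderiv 𝓘(ℂ, E) I (extChartAt I x₁).symm (extChartAt I x₁ x)).comp
      (mfderiv I 𝓘(ℂ, E) (extChartAt I x₁) x) = ContinuousLinearMap.id ℂ E := by
    have h2 := mfderiv_comp x (mdifferentiableAt_extChartAt_symm
      ((extChartAt I x₁).map_source hx))
      (mdifferentiableAt_extChartAt (by rwa [← extChartAt_source I x₁]))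
    rw [← h2]
    have h3 : (extChartAt I x₁).symm ∘ extChartAt I x₁ =ᶠ[𝓝 x] id := by
      filter_upwards [(isOpen_extChartAt_source x₁).mem_nhds hx] with y hy
      exact (extChartAt I x₁).left_inv hy
    rw [h3.mfderiv_eq]
    exact mfderiv_id
  -- `β y` and `β x` live in different fibres, which are both equal to `E` by definition.
  have h4 : ∀ y, y = x → ∀ v : Fin q → E,
      (β y : E [⋀^Fin q]→L[ℝ] ℂ) v = (β x : E [⋀^Fin q]→L[ℝ] ℂ) v := by
    rintro y rfl v; rfl
  ext v
  change (β ((extChartAt I x₁).symm (extChartAt I x₁ x)) : E [⋀^Fin q]→L[ℝ] ℂ) (fun i =>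
    ((mfderiv 𝓘(ℂ, E) I (extChartAt I x₁).symm (extChartAt I x₁ x)).comp
      (mfderiv I 𝓘(ℂ, E) (extChartAt I x₁) x)) (v i)) = _
  refine (h4 _ ((extChartAt I x₁).left_inv hx) _).trans ?_
  exact congrArg (fun w : Fin q → E => (β x : E [⋀^Fin q]→L[ℝ] ℂ) w)
    (funext fun i => congrArg (fun L : E →L[ℂ] E => L (v i)) h1)

open Classical in
/-- The pullback to `M` of a field of forms on the model space under the chart around `x₁`,
extended by zero outside the domain of that chart. -/
def chartPullback {q : ℕ} (x₁ : M) (θ : E → E [⋀^Fin q]→L[ℝ] ℂ) : FormField I M q := fun x =>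
  if x ∈ (extChartAt I x₁).source then
    (θ (extChartAt I x₁ x)).compContinuousLinearMap
      ((mfderiv I 𝓘(ℂ, E) (extChartAt I x₁) x).restrictScalars ℝ)
  else 0

/-- In the chart around `x₀`, the pullback of `θ` under the chart around `x₁` is the pullback of `θ`
under the transition map. -/
lemma inChart_chartPullback {q : ℕ} {θ : E → E [⋀^Fin q]→L[ℝ] ℂ} {x₀ x₁ : M} {z : E}
    (hz : z ∈ (extChartAt I x₀).target)
    (hz' : (extChartAt I x₀).symm z ∈ (extChartAt I x₁).source) :
    (chartPullback x₁ θ : FormField I M q).inChart x₀ z =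
      pullback (extChartAt I x₁ ∘ (extChartAt I x₀).symm) θ z := by
  rw [FormField.inChart, chartPullback, if_pos hz', pullback, fderiv_transition hz hz']
  rfl

lemma inChart_chartPullback_eventuallyEq {q : ℕ} {θ : E → E [⋀^Fin q]→L[ℝ] ℂ} {x₀ x₁ : M} {z : E}
    (hz : z ∈ (extChartAt I x₀).target)
    (hz' : (extChartAt I x₀).symm z ∈ (extChartAt I x₁).source) :
    (chartPullback x₁ θ : FormField I M q).inChart x₀ =ᶠ[𝓝 z]
      pullback (extChartAt I x₁ ∘ (extChartAt I x₀).symm) θ := by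
  filter_upwards [(isOpen_extChartAt_target x₀).mem_nhds hz,
    (continuousAt_extChartAt_symm'' hz).eventually ((isOpen_extChartAt_source x₁).mem_nhds hz')]
    with w hw hw'
  exact inChart_chartPullback hw hw'

/-- A form of top degree supported in a closed subset `C` of a chart domain has a primitive
supported in `C`, provided that the image `D` of `C` in the chart is closed and is a union of
complex lines of a fixed direction. -/
theorem exists_dbar_eq_of_support {q : ℕ} [FiniteDimensional ℂ E]
    (hE : Module.finrank ℂ E = q + 1) {e : E} (he : e ≠ 0) {x₁ : M} {C : Set M} (hC : IsClosed C)
    (hCs : C ⊆ (extChartAt I x₁).source) {D : Set E} (hD : IsClosed D)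
    (hDt : D ⊆ (extChartAt I x₁).target)
    (hCD : ∀ x ∈ (extChartAt I x₁).source, x ∈ C ↔ extChartAt I x₁ x ∈ D)
    (hDe : ∀ z ∉ D, ∀ w : ℂ, z + w • e ∉ D)
    {β : FormField I M (q + 1)} (hβ : β ∈ forms I M (q + 1)) (hβ0 : ∀ x ∉ C, β x = 0) :
    ∃ α ∈ forms I M q, α.dbar = β ∧ ∀ x ∉ C, α x = 0 := by
  classical
  -- the expression of `β` in the chart, extended by zero to the whole vector space
  let η : E → E [⋀^Fin (q + 1)]→L[ℝ] ℂ := fun z =>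
    if z ∈ (extChartAt I x₁).target then β.inChart x₁ z else 0
  have hηt : ∀ z ∈ (extChartAt I x₁).target, η z = β.inChart x₁ z := fun z hz => if_pos hz
  have hη0 : ∀ z ∉ D, η z = 0 := fun z hz => by
    by_cases hzt : z ∈ (extChartAt I x₁).target
    · have h1 : (extChartAt I x₁).symm z ∉ C := fun h => by
        rw [hCD _ ((extChartAt I x₁).map_target hzt), (extChartAt I x₁).right_inv hzt] at h
        exact hz h
      rw [hηt z hzt, FormField.inChart, hβ0 _ h1]
      rfl
    · exact if_neg hzt
  have hηs : ContDiff ℝ ∞ η := by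
    rw [contDiff_iff_contDiffAt]
    intro z
    by_cases hz : z ∈ D
    · have ht := (isOpen_extChartAt_target x₁).mem_nhds (hDt hz)
      refine ((hβ.2 x₁).contDiffAt ht).congr_of_eventuallyEq ?_
      filter_upwards [ht] with w hw using hηt w hw
    · refine contDiffAt_const (c := 0) |>.congr_of_eventuallyEq ?_
      filter_upwards [hD.isOpen_compl.mem_nhds hz] with w hw using hη0 w hw
  have hη1 : ∀ z, IsType0 (η z) := fun z => by
    by_cases hz : z ∈ (extChartAt I x₁).target
    · rw [hηt z hz]
      exact (hβ.1 _).compContinuousLinearMap _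
    · rw [show η z = 0 from if_neg hz]
      intro v i c; simp
  obtain ⟨θ, hθ, hθ1, hθη, hθ0⟩ := exists_dbarLocal_eq hE he hηs hη1
  have hθD : ∀ z ∉ D, θ z = 0 := fun z hz => hθ0 z fun w => hη0 _ (hDe z hz w)
  have hα0 : ∀ x ∉ C, (chartPullback x₁ θ : FormField I M q) x = 0 := fun x hx => by
    by_cases hxs : x ∈ (extChartAt I x₁).source
    · rw [chartPullback, if_pos hxs, hθD _ fun h => hx ((hCD x hxs).2 h)]
      rfl
    · exact if_neg hxs
  refine ⟨chartPullback x₁ θ, ⟨fun x => ?_, fun x₀ z hz => ?_⟩, funext fun x => ?_, hα0⟩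
  · by_cases hxs : x ∈ (extChartAt I x₁).source
    · rw [chartPullback, if_pos hxs]
      exact (hθ1 _).compContinuousLinearMap _
    · rw [show (chartPullback x₁ θ : FormField I M q) x = 0 from if_neg hxs]
      intro v i c; simp
  · refine ContDiffAt.contDiffWithinAt ?_
    by_cases hz' : (extChartAt I x₀).symm z ∈ (extChartAt I x₁).source
    · exact (contDiffAt_pullback (contDiffAt_transition hz hz') hθ.contDiffAt).congr_of_eventuallyEq
        (inChart_chartPullback_eventuallyEq hz hz')
    · have h1 : ∀ᶠ y in 𝓝 ((extChartAt I x₀).symm z),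
          (chartPullback x₁ θ : FormField I M q) y = (0 : FormField I M q) y := by
        filter_upwards [hC.isOpen_compl.mem_nhds fun h => hz' (hCs h)] with y hy using hα0 y hy
      have h2 := ((forms I M q).zero_mem.2 x₀).contDiffAt
        ((isOpen_extChartAt_target x₀).mem_nhds hz)
      exact h2.congr_of_eventuallyEq (inChart_eventuallyEq hz h1)
  · by_cases hxs : x ∈ (extChartAt I x₁).source
    · have hxs' : (extChartAt I x).symm (extChartAt I x x) ∈ (extChartAt I x₁).source := by
        rwa [extChartAt_to_inv]
      have hxt := mem_extChartAt_target (I := I) x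
      have h1 : dbarLocal ((chartPullback x₁ θ : FormField I M q).inChart x) (extChartAt I x x) =
          dbarLocal (pullback (extChartAt I x₁ ∘ (extChartAt I x).symm) θ) (extChartAt I x x) := by
        rw [dbarLocal, dbarLocal, (inChart_chartPullback_eventuallyEq hxt hxs').fderiv_eq]
      rw [FormField.dbar, h1, dbarLocal_pullback (contDiffAt_transition hxt hxs')
        (hθ.differentiable (by simp) _) hθ1, hθη]
      have h2 : (extChartAt I x₁ ∘ (extChartAt I x).symm) (extChartAt I x x) =
          extChartAt I x₁ x := by
        simp only [Function.comp, extChartAt_to_inv]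
      rw [h2, hηt _ ((extChartAt I x₁).map_source hxs), ← inChart_apply_comp_mfderiv β hxs,
        ← fderiv_transition_comp_mfderiv hxs]
      rfl
    · have hx : x ∉ C := fun h => hxs (hCs h)
      have h1 : ∀ᶠ y in 𝓝 x,
          (chartPullback x₁ θ : FormField I M q) y = (0 : FormField I M q) y := by
        filter_upwards [hC.isOpen_compl.mem_nhds hx] with y hy using hα0 y hy
      rw [dbar_congr h1, dbar_zero, hβ0 x hx]
      rfl

end ManifoldForms

/-! ### The total space of a vector bundle -/

/-- A complex manifold, regarded as a real smooth manifold. -/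
lemma isManifold_real (V : Type*) [NormedAddCommGroup V] [NormedSpace ℂ V] (Y : Type*)
    [TopologicalSpace Y] [ChartedSpace V Y] [IsManifold 𝓘(ℂ, V) ω Y] : IsManifold 𝓘(ℝ, V) ∞ Y := by
  refine isManifold_of_contDiffOn 𝓘(ℝ, V) ∞ Y fun e e' he he' => ?_
  have h := HasGroupoid.compatible (G := contDiffGroupoid ω 𝓘(ℂ, V)) he he'
  rw [contDiffGroupoid, mem_groupoid_of_pregroupoid, contDiffPregroupoid] at h
  exact (h.1.restrict_scalars ℝ).of_le le_top

section TotalSpace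

variable {V : Type*} [NormedAddCommGroup V] [NormedSpace ℂ V]
    {Y : Type*} [TopologicalSpace Y] [ChartedSpace V Y]
    {F : Type*} [NormedAddCommGroup F] [NormedSpace ℂ F]
    {K : Y → Type*} [∀ y, TopologicalSpace (K y)] [TopologicalSpace (TotalSpace F K)]
    [FiberBundle F K]

lemma extChartAt_totalSpace_target (p : TotalSpace F K) :
    (extChartAt (𝓘(ℂ, V).prod 𝓘(ℂ, F)) p).target =
      ((chartAt V p.proj).target ∩
        (chartAt V p.proj).symm ⁻¹' (trivializationAt F K p.proj).baseSet) ×ˢ univ := by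
  rw [FiberBundle.extChartAt_target]
  simp

lemma mem_extChartAt_totalSpace_source {p x : TotalSpace F K} :
    x ∈ (extChartAt (𝓘(ℂ, V).prod 𝓘(ℂ, F)) p).source ↔
      x.proj ∈ (chartAt V p.proj).source ∩ (trivializationAt F K p.proj).baseSet := by
  rw [FiberBundle.extChartAt]
  simp only [mfld_simps, Trivialization.mem_source]
  constructor
  · rintro ⟨h1, h2⟩
    rw [Trivialization.coe_fst' _ h1] at h2
    exact ⟨h2, h1⟩
  · rintro ⟨h1, h2⟩
    rw [Trivialization.coe_fst' _ h2]
    exact ⟨h2, h1⟩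

lemma extChartAt_totalSpace_apply_fst {p x : TotalSpace F K}
    (hx : x ∈ (extChartAt (𝓘(ℂ, V).prod 𝓘(ℂ, F)) p).source) :
    (extChartAt (𝓘(ℂ, V).prod 𝓘(ℂ, F)) p x).1 = chartAt V p.proj x.proj := by
  have h := mem_extChartAt_totalSpace_source.1 hx
  rw [FiberBundle.extChartAt]
  simp only [mfld_simps]
  rw [Trivialization.coe_fst' _ h.2]

/-- The charts of the total space cover those of the base. -/
lemma proj_extChartAt_totalSpace_symm {p : TotalSpace F K} {z : V × F}
    (hz : z ∈ (extChartAt (𝓘(ℂ, V).prod 𝓘(ℂ, F)) p).target) :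
    ((extChartAt (𝓘(ℂ, V).prod 𝓘(ℂ, F)) p).symm z).proj = (chartAt V p.proj).symm z.1 := by
  have h1 := (extChartAt (𝓘(ℂ, V).prod 𝓘(ℂ, F)) p).map_target hz
  have h2 := extChartAt_totalSpace_apply_fst h1
  rw [(extChartAt (𝓘(ℂ, V).prod 𝓘(ℂ, F)) p).right_inv hz] at h2
  rw [h2, (chartAt V p.proj).left_inv (mem_extChartAt_totalSpace_source.1 h1).1]

/-- The product of a smooth form of type `(0,q)` on the total space with the pullback of a real
smooth function on the base is again such a form. -/
lemma smul_proj_mem_forms {q : ℕ} {β : FormField (𝓘(ℂ, V).prod 𝓘(ℂ, F)) (TotalSpace F K) q}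
    (hβ : β ∈ forms (𝓘(ℂ, V).prod 𝓘(ℂ, F)) (TotalSpace F K) q) [IsManifold 𝓘(ℝ, V) ∞ Y]
    (χ : C^∞⟮𝓘(ℝ, V), Y; 𝓘(ℝ), ℝ⟯) :
    (fun x => (χ x.proj : ℂ) • β x : FormField (𝓘(ℂ, V).prod 𝓘(ℂ, F)) (TotalSpace F K) q) ∈
      forms (𝓘(ℂ, V).prod 𝓘(ℂ, F)) (TotalSpace F K) q := by
  refine ⟨fun x v i c => ?_, fun p => ?_⟩
  · have := hβ.1 x v i c
    simp only [ContinuousAlternatingMap.smul_apply, this, smul_eq_mul]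
    ring
  · have h1 : ContDiffOn ℝ ∞ (fun y => χ ((chartAt V p.proj).symm y))
        (chartAt V p.proj).target := by
      rw [← contMDiffOn_iff_contDiffOn]
      exact χ.contMDiff.comp_contMDiffOn (contMDiffOn_chart_symm (I := 𝓘(ℝ, V)))
    have h2 : ContDiffOn ℝ ∞ (fun z : V × F => (χ ((chartAt V p.proj).symm z.1) : ℂ))
        (extChartAt (𝓘(ℂ, V).prod 𝓘(ℂ, F)) p).target := by
      refine Complex.ofRealCLM.contDiff.comp_contDiffOn (h1.comp contDiff_fst.contDiffOn ?_)
      intro z hz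
      rw [extChartAt_totalSpace_target] at hz
      exact hz.1.1
    refine (h2.smul (hβ.2 p)).congr fun z hz => ?_
    change _ = (χ ((chartAt V p.proj).symm z.1) : ℂ) • β.inChart p z
    rw [← proj_extChartAt_totalSpace_symm hz]
    rfl

end TotalSpace

/-- Every smooth form of top type `(0, n + k)` on the total space is `∂̄`-exact. -/
theorem exists_dbar_eq_of_totalSpace
    {V : Type*} [NormedAddCommGroup V] [NormedSpace ℂ V] [FiniteDimensional ℂ V]
    {Y : Type*} [TopologicalSpace Y] [T2Space Y] [SecondCountableTopology Y]
    [ChartedSpace V Y] [IsManifold 𝓘(ℂ, V) ω Y]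
    {F : Type*} [NormedAddCommGroup F] [NormedSpace ℂ F] [FiniteDimensional ℂ F]
    (K : Y → Type*) [∀ y, AddCommGroup (K y)] [∀ y, Module ℂ (K y)]
    [∀ y, TopologicalSpace (K y)] [TopologicalSpace (TotalSpace F K)]
    [FiberBundle F K] [VectorBundle ℂ F K] [ContMDiffVectorBundle ω F K 𝓘(ℂ, V)]
    (hF : 0 < Module.finrank ℂ F) {q : ℕ}
    (hq : Module.finrank ℂ V + Module.finrank ℂ F = q + 1)
    {β : FormField (𝓘(ℂ, V).prod 𝓘(ℂ, F)) (TotalSpace F K) (q + 1)}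
    (hβ : β ∈ forms (𝓘(ℂ, V).prod 𝓘(ℂ, F)) (TotalSpace F K) (q + 1)) :
    ∃ α ∈ forms (𝓘(ℂ, V).prod 𝓘(ℂ, F)) (TotalSpace F K) q, α.dbar = β := by
  have hE : Module.finrank ℂ (V × F) = q + 1 := by rw [Module.finrank_prod, hq]
  have : FiniteDimensional ℝ V := FiniteDimensional.complexToReal V
  have : LocallyCompactSpace V := 
    have := FiniteDimensional.proper ℂ V
    inferInstance
  have : LocallyCompactSpace Y := ChartedSpace.locallyCompactSpace V Y
  have : IsManifold 𝓘(ℝ, V) ∞ Y := isManifold_real V Y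
  obtain ⟨f₀, hf₀⟩ : ∃ f : F, f ≠ 0 :=
    have := Module.nontrivial_of_finrank_pos hF
    exists_ne 0
  -- a partition of unity on the base, with compact supports in trivializing chart domains
  let O : Y → Set Y := fun y => (chartAt V y).source ∩ (trivializationAt F K y).baseSet
  have hO : ∀ y, IsOpen (O y) := fun y =>
    (chartAt V y).open_source.inter (trivializationAt F K y).open_baseSet
  have hyO : ∀ y, y ∈ O y := fun y =>
    ⟨mem_chart_source V y, FiberBundle.mem_baseSet_trivializationAt' y⟩
  choose S hSc hyS hSO using fun y => exists_compact_subset (hO y) (hyO y)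
  obtain ⟨χ, hχ⟩ := SmoothPartitionOfUnity.exists_isSubordinate 𝓘(ℝ, V) isClosed_univ
    (fun y => interior (S y)) (fun y => isOpen_interior)
    (fun y _ => mem_iUnion.2 ⟨y, hyS y⟩)
  have hχS : ∀ y, tsupport (χ y) ⊆ S y := fun y => (hχ y).trans interior_subset
  have hπ : Continuous (TotalSpace.proj : TotalSpace F K → Y) := FiberBundle.continuous_proj F K
  let C : Y → Set (TotalSpace F K) := fun y => TotalSpace.proj ⁻¹' tsupport (χ y)
  have hC : LocallyFinite C := χ.locallyFinite.closure.preimage_continuous hπ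
  let β' : Y → FormField (𝓘(ℂ, V).prod 𝓘(ℂ, F)) (TotalSpace F K) (q + 1) :=
    fun y x => (χ y x.proj : ℂ) • β x
  have hβ' : ∀ y, β' y ∈ forms (𝓘(ℂ, V).prod 𝓘(ℂ, F)) (TotalSpace F K) (q + 1) :=
    fun y => smul_proj_mem_forms hβ (χ y)
  have hχ0 : ∀ y, ∀ x ∉ C y, χ y x.proj = 0 := fun y x hx => image_eq_zero_of_notMem_tsupport hx
  have hloc : ∀ y, ∃ α ∈ forms (𝓘(ℂ, V).prod 𝓘(ℂ, F)) (TotalSpace F K) q,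
      α.dbar = β' y ∧ ∀ x ∉ C y, α x = 0 := fun y => by
    have hT : IsCompact (tsupport (χ y)) := (hSc y).of_isClosed_subset (isClosed_tsupport _) (hχS y)
    have hTO : tsupport (χ y) ⊆ O y := (hχS y).trans (hSO y)
    have hD : IsCompact (chartAt V y '' tsupport (χ y)) :=
      hT.image_of_continuousOn ((chartAt V y).continuousOn.mono fun t ht => (hTO ht).1)
    refine exists_dbar_eq_of_support hE (e := ((0 : V), f₀)) (by simp [hf₀])
      (x₁ := (⟨y, 0⟩ : TotalSpace F K)) (C := C y) ((isClosed_tsupport _).preimage hπ)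
      (fun x hx => mem_extChartAt_totalSpace_source.2 (hTO hx))
      (D := Prod.fst ⁻¹' (chartAt V y '' tsupport (χ y))) (hD.isClosed.preimage continuous_fst)
      ?_ ?_ ?_ (hβ' y) ?_
    · rintro z ⟨t, ht, htz⟩
      rw [extChartAt_totalSpace_target]
      refine ⟨⟨?_, ?_⟩, mem_univ _⟩
      · rw [← htz]; exact (chartAt V y).map_source (hTO ht).1
      · rw [mem_preimage, ← htz, (chartAt V y).left_inv (hTO ht).1]
        exact (hTO ht).2
    · intro x hx
      change _ ↔ (extChartAt (𝓘(ℂ, V).prod 𝓘(ℂ, F)) (⟨y, 0⟩ : TotalSpace F K) x).1 ∈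
        chartAt V y '' tsupport (χ y)
      rw [extChartAt_totalSpace_apply_fst hx]
      refine ⟨fun h => ⟨_, h, rfl⟩, ?_⟩
      rintro ⟨t, ht, htx⟩
      have := (chartAt V y).injOn (hTO ht).1 (mem_extChartAt_totalSpace_source.1 hx).1 htx
      change x.proj ∈ tsupport (χ y)
      rwa [← this]
    -- Translation by a multiple of `(0, f₀)` does not change the first coordinate.
    · intro z hz w hw
      exact hz (by simpa using hw)
    · intro x hx
      have h : (χ y x.proj : ℂ) = 0 := by rw [hχ0 y x hx, Complex.ofReal_zero]
      exact (congrArg (fun c : ℂ => (c • β) x) h).trans (congrFun (zero_smul ℂ β) x)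
  choose α hα hαβ hα0 using hloc
  refine exists_dbar_eq_of_locallyFinite hC hα hα0 fun x s hs => ?_
  have h1 : ∑ y ∈ s, χ y x.proj = 1 := by
    rw [← χ.sum_eq_one (mem_univ x.proj)]
    refine (finsum_eq_sum_of_support_subset _ fun y hy => ?_).symm
    exact hs y (by by_contra h; exact hy (hχ0 y x h))
  calc ∑ y ∈ s, (α y).dbar x = ∑ y ∈ s, (χ y x.proj : ℂ) • β x :=
        Finset.sum_congr rfl fun y _ => by rw [hαβ]
    _ = β x := by rw [← Finset.sum_smul, ← Complex.ofReal_sum, h1, Complex.ofReal_one, one_smul]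

end Dolbeault

end

theorem mainTheorem11
    {V : Type*} [NormedAddCommGroup V] [NormedSpace ℂ V] [FiniteDimensional ℂ V]
    {Y : Type*} [TopologicalSpace Y] [T2Space Y] [SecondCountableTopology Y]
    [ChartedSpace V Y] [IsManifold 𝓘(ℂ, V) ω Y]
    {F : Type*} [NormedAddCommGroup F] [NormedSpace ℂ F] [FiniteDimensional ℂ F]
    (K : Y → Type*) [∀ y, AddCommGroup (K y)] [∀ y, Module ℂ (K y)]
    [∀ y, TopologicalSpace (K y)] [TopologicalSpace (TotalSpace F K)]
    [FiberBundle F K] [VectorBundle ℂ F K] [ContMDiffVectorBundle ω F K 𝓘(ℂ, V)]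
    (hF : 0 < Module.finrank ℂ F) :
    Subsingleton (Dolbeault.Cohomology (𝓘(ℂ, V).prod 𝓘(ℂ, F)) (TotalSpace F K)
      (Module.finrank ℂ V + Module.finrank ℂ F)) := by
  obtain ⟨q, hq⟩ : ∃ q, Module.finrank ℂ V + Module.finrank ℂ F = q + 1 :=
    ⟨Module.finrank ℂ V + Module.finrank ℂ F - 1, by omega⟩
  rw [hq]
  refine Submodule.Quotient.subsingleton_iff.2 (Submodule.submoduleOf_eq_top.2 ?_)
  rintro β ⟨hβ, -⟩
  exact ⟨hβ, Dolbeault.exists_dbar_eq_of_totalSpace K hF hq hβ⟩
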